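/- Let $k$ be a perfect field of characteristic $p>0$. A normal $k$-variety is an integral, separated scheme of finite type over $k$ all of whose local rings are integrally closed. A finite surjective morphism $g\colon X\to Z$ of normal $k$-varieties is called purely inseparable if the extension of function fields $k(Z)\subseteq k(X)$ is purely inseparable; it is called purely inseparable of height one if, moreover, there is a morphism of schemes $h\colon Z\to X$ (not necessarily over $k$) such that $h\circ g=F_X$ is the absolute Frobenius of $X$. For a finite surjective $k$-morphism $f\colon X\to Y$ of normal $k$-varieties let $\mathcal F_f\subseteq\mathcal T_X=(\Omega^1_X)^\vee$ be the subsheaf of the derivations that annihilate $f^{-1}\mathcal O_Y\subseteq\mathcal O_X$. A foliation on $X$ is a saturated $\mathcal O_X$-submodule sheaf of $\mathcal T_X$ closed under the Lie bracket; it is $p$-closed if it contains the $p$-fold composition of each of its sections. The quotient of $X$ by a foliation $\mathcal F$ is the $k$-morphism $X\to\operatorname{Spec}_X\mathcal A_{\mathcal F}$, where $\mathcal A_{\mathcal F}\subseteq (F_X)_*\mathcal O_X$ is the sheaf of functions annihilated by $\mathcal F$, with $\mathcal O_X$ acting through $p$-th powers. Proposition (factorisation). Let $f\colon X\to Y$ be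 a purely inseparable $k$-morphism of normal $k$-varieties. Then there exist a positive integer $l$, normal $k$-varieties $Z_1,\dots,Z_l$ with $Z_1=X$ and $Z_l=Y$, and $k$-morphisms $$X=Z_1\to Z_2\to\cdots\to Z_l=Y$$ whose composite is $f$ (for $l=1$ this means that $X=Y$ and $f$ is the identity), such that for every $1\le i<l$ the morphism $Z_i\to Z_{i+1}$ is purely inseparable of height one. Moreover, they can be chosen so that for every $1\le i<l$, if $f_i\colon Z_i\to Y$ denotes the composite of the morphisms from $Z_i$ on, then $\mathcal F_{f_i}$ is a $p$-closed foliation on $Z_i$ and $Z_i\to Z_{i+1}$ is, up to isomorphism, the quotient of $Z_i$ by $\mathcal F_{f_i}$. -/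

import Mathlib

universe u

open CategoryTheory AlgebraicGeometry TopologicalSpace Opposite

namespace InsepFactor

noncomputable section

/-! ### Normal varieties -/

/-- A `k`-scheme is a normal `k`-variety if it is integral, separated and of finite type over `k`,
and all its local rings are integrally closed domains. -/
structure IsNormalVariety (k : Type u) [Field k] (X : Over (Spec (CommRingCat.of k))) : Prop where
  isIntegral : IsIntegral X.left
  isSeparated : IsSeparated X.hom
  locallyOfFiniteType : LocallyOfFiniteType X.hom
  quasiCompact : QuasiCompact X.hom
  normal : ∀ x : X.left, IsIntegrallyClosed (X.left.presheaf.stalk x)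

/-- The category of normal `k`-varieties and `k`-morphisms. -/
abbrev NormalVariety (k : Type u) [Field k] :=
  ObjectProperty.FullSubcategory (IsNormalVariety k)

/-- The underlying scheme of a normal `k`-variety. -/
abbrev NormalVariety.scheme {k : Type u} [Field k] (X : NormalVariety k) : Scheme.{u} :=
  X.obj.left

/-- The morphism of schemes underlying a `k`-morphism. -/
abbrev schemeMap {k : Type u} [Field k] {X Y : NormalVariety k} (f : X ⟶ Y) :
    X.scheme ⟶ Y.scheme :=
  f.hom.left

instance {k : Type u} [Field k] (X : NormalVariety k) : IsIntegral X.scheme :=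
  X.property.isIntegral

/-- The constant functions on an open subset. -/
def constants {k : Type u} [Field k] (X : NormalVariety k) (U : X.scheme.Opens) :
    k →+* Γ(X.scheme, U) :=
  (X.scheme.presheaf.map (homOfLE (le_top : U ≤ ⊤)).op).hom.comp
    ((X.obj.hom.appTop).hom.comp (Scheme.ΓSpecIso (CommRingCat.of k)).inv.hom)

/-! ### The absolute Frobenius -/

lemma natCast_sections_eq_zero (p : ℕ) (X : Scheme.{u}) (hX : (p : Γ(X, ⊤)) = 0) (U : X.Opens) :
    (p : Γ(X, U)) = 0 := by
  have := congrArg (X.presheaf.map (homOfLE (le_top : U ≤ ⊤)).op).hom hX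
  simpa using this

/-- The `p`-th power map of a commutative ring in which the prime `p` is zero. -/
def powHom (p : ℕ) [hp : Fact p.Prime] (R : Type u) [CommRing R] (hR : (p : R) = 0) : R →+* R where
  toFun s := s ^ p
  map_one' := one_pow p
  map_mul' a b := mul_pow a b p
  map_zero' := zero_pow hp.out.ne_zero
  map_add' a b := by rw [add_pow_prime_eq hp.out a b, hR]; ring

/-- The absolute Frobenius as a morphism of ringed spaces. -/
def frobeniusHom (p : ℕ) [Fact p.Prime] (X : Scheme.{u}) (hX : (p : Γ(X, ⊤)) = 0) :
    X.toPresheafedSpace ⟶ X.toPresheafedSpace where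
  base := 𝟙 _
  c :=
    { app := fun U => CommRingCat.ofHom
        (powHom p Γ(X, U.unop) (natCast_sections_eq_zero p X hX U.unop))
      naturality := by
        intro U V i
        ext s
        exact (map_pow (X.presheaf.map i).hom s p).symm }

/-- The absolute Frobenius of a scheme of characteristic `p`: the identity on the underlying
topological space and `s ↦ s ^ p` on functions. -/
def absoluteFrobenius (p : ℕ) [hp : Fact p.Prime] (X : Scheme.{u}) (hX : (p : Γ(X, ⊤)) = 0) :
    X ⟶ X where
  toHom := frobeniusHom p X hX
  prop := by
    intro x
    refine ⟨fun a ha => ?_⟩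
    obtain ⟨U, hxU, s, rfl⟩ := X.presheaf.exists_germ_eq a
    have h : ((frobeniusHom p X hX).stalkMap x).hom
        (X.presheaf.germ U ((frobeniusHom p X hX).base x) hxU s) =
        X.presheaf.germ U x hxU (s ^ p) :=
      PresheafedSpace.stalkMap_germ_apply (frobeniusHom p X hX) U x hxU s
    have h2 : IsUnit ((X.presheaf.germ U x hxU s) ^ p) := by
      rw [← map_pow, ← h]
      exact ha
    exact (isUnit_pow_iff hp.out.ne_zero).mp h2

/-- The absolute Frobenius is the identity on points. -/
lemma absoluteFrobenius_apply (p : ℕ) [Fact p.Prime] (X : Scheme.{u})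
    (hX : (p : Γ(X, ⊤)) = 0) (x : X) : absoluteFrobenius p X hX x = x :=
  rfl

/-- The absolute Frobenius is the `p`-th power map on functions. -/
lemma absoluteFrobenius_app (p : ℕ) [Fact p.Prime] (X : Scheme.{u})
    (hX : (p : Γ(X, ⊤)) = 0) (U : X.Opens) (s : Γ(X, U)) :
    (absoluteFrobenius p X hX).app U s = s ^ p :=
  rfl

lemma natCast_eq_zero (p : ℕ) {k : Type u} [Field k] [CharP k p] (X : NormalVariety k) :
    (p : Γ(X.scheme, ⊤)) = 0 := by
  rw [← map_natCast (constants X ⊤), CharP.cast_eq_zero, map_zero]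

/-- The absolute Frobenius `F_X` of a normal variety in characteristic `p`. -/
def frob (p : ℕ) [Fact p.Prime] {k : Type u} [Field k] [CharP k p] (X : NormalVariety k) :
    X.scheme ⟶ X.scheme :=
  absoluteFrobenius p X.scheme (natCast_eq_zero p X)

/-! ### Purely inseparable morphisms -/

lemma map_genericPoint {X Y : Scheme.{u}} [IsIntegral X] [IsIntegral Y] (g : X ⟶ Y)
    (hg : Surjective g) : g (genericPoint X) = genericPoint Y := by
  apply ((genericPoint_spec Y).eq _).symm
  have h := (genericPoint_spec X).image g.continuous
  rw [Set.image_univ, hg.surj.range_eq, closure_univ] at h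
  exact h

/-- The extension of function fields `k(Y) → k(X)` induced by a surjective morphism `X → Y` of
integral schemes. -/
def functionFieldMap {X Y : Scheme.{u}} [IsIntegral X] [IsIntegral Y] (g : X ⟶ Y)
    (hg : Surjective g) : Y.functionField →+* X.functionField :=
  (Y.presheaf.stalkSpecializes (specializes_of_eq (map_genericPoint g hg)) ≫
    g.stalkMap (genericPoint X)).hom

/-- A purely inseparable morphism of integral schemes: finite, surjective, with purely
inseparable extension of function fields. -/
def IsPurelyInseparableHom {X Y : Scheme.{u}} [IsIntegral X] [IsIntegral Y] (g : X ⟶ Y) : Prop :=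
  IsFinite g ∧ ∃ hg : Surjective g,
    @IsPurelyInseparable Y.functionField X.functionField _ _ (functionFieldMap g hg).toAlgebra

/-- A purely inseparable `k`-morphism `g : X → Z` has height one if the absolute Frobenius of `X`
factors through `g`, by a morphism that need not be over `k`. -/
def IsPurelyInseparableOfHeightOne (p : ℕ) [Fact p.Prime] {k : Type u} [Field k] [CharP k p]
    {X Z : NormalVariety k} (g : X ⟶ Z) : Prop :=
  IsPurelyInseparableHom (schemeMap g) ∧
    ∃ h : Z.scheme ⟶ X.scheme, schemeMap g ≫ h = frob p X

/-! ### Vector fields and foliations -/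

variable {k : Type u} [Field k]

/-- Restriction of functions. -/
def res {X : NormalVariety k} {U V : X.scheme.Opens} (h : V ≤ U) :
    Γ(X.scheme, U) →+* Γ(X.scheme, V) :=
  (X.scheme.presheaf.map (homOfLE h).op).hom

/-- A section over `U` of the tangent sheaf `T_X`, the dual of the sheaf of Kähler differentials
of `X` over `k`: by the universal property, a `k`-linear derivation of the sheaf of rings
`O_X` restricted to `U`. -/
@[ext]
structure TangentSection (X : NormalVariety k) (U : X.scheme.Opens) where
  der : ∀ V : X.scheme.Opens, V ≤ U → Derivation ℤ Γ(X.scheme, V) Γ(X.scheme, V)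
  der_constants : ∀ V hV (a : k), der V hV (constants X V a) = 0
  der_res : ∀ V hV W (h : W ≤ V) (s : Γ(X.scheme, V)),
    der W (h.trans hV) (res h s) = res h (der V hV s)

namespace TangentSection

variable {X : NormalVariety k} {U : X.scheme.Opens}

/-- Restriction of vector fields. -/
def restrict (D : TangentSection X U) {V : X.scheme.Opens} (h : V ≤ U) : TangentSection X V where
  der W hW := D.der W (hW.trans h)
  der_constants W hW := D.der_constants W (hW.trans h)
  der_res W hW := D.der_res W (hW.trans h)

instance : Zero (TangentSection X U) where
  zero :=
    { der := fun _ _ => 0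
      der_constants := by intros; rfl
      der_res := by intros; simp }

instance : Add (TangentSection X U) where
  add D E :=
    { der := fun V hV => D.der V hV + E.der V hV
      der_constants := by intros; simp [D.der_constants, E.der_constants]
      der_res := by
        intro V hV W h s
        simp [D.der_res V hV W h, E.der_res V hV W h] }

instance : SMul Γ(X.scheme, U) (TangentSection X U) where
  smul r D :=
    { der := fun V hV => res hV r • D.der V hV
      der_constants := by intros; simp [D.der_constants]
      der_res := by
        intro V hV W h s
        have : res (h.trans hV) r = res h (res hV r) := by
          simp only [res, ← RingHom.comp_apply, ← CommRingCat.hom_comp, ← Functor.map_comp]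
          rfl
        simp [D.der_res V hV W h, this] }

/-- The Lie bracket of vector fields. -/
instance : Bracket (TangentSection X U) (TangentSection X U) where
  bracket D E :=
    { der := fun V hV => ⁅D.der V hV, E.der V hV⁆
      der_constants := by
        intros; simp [Derivation.commutator_apply, D.der_constants, E.der_constants]
      der_res := by
        intro V hV W h s
        simp [Derivation.commutator_apply, D.der_res V hV W h, E.der_res V hV W h] }

end TangentSection

/-- A family of sets of sections of the tangent sheaf is a foliation if it is a subsheaf of
`O_X`-modules that is saturated (the quotient is torsion free) and closed under the Lie bracket. -/
structure IsFoliation {X : NormalVariety k} (F : ∀ U : X.scheme.Opens, Set (TangentSection X U)) :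
    Prop where
  zero_mem : ∀ U, 0 ∈ F U
  add_mem : ∀ U, ∀ D ∈ F U, ∀ E ∈ F U, D + E ∈ F U
  smul_mem : ∀ U (r : Γ(X.scheme, U)), ∀ D ∈ F U, r • D ∈ F U
  restrict_mem : ∀ U, ∀ D ∈ F U, ∀ V (h : V ≤ U), D.restrict h ∈ F V
  mem_of_local : ∀ U (D : TangentSection X U),
    (∀ x ∈ U, ∃ (V : X.scheme.Opens) (h : V ≤ U), x ∈ V ∧ D.restrict h ∈ F V) → D ∈ F U
  saturated : ∀ U (r : Γ(X.scheme, U)) (D : TangentSection X U), r ≠ 0 → r • D ∈ F U → D ∈ F U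
  bracket_mem : ∀ U, ∀ D ∈ F U, ∀ E ∈ F U, ⁅D, E⁆ ∈ F U

/-- A foliation is `p`-closed if it contains the `p`-fold composition of each of its sections. -/
structure IsPClosedFoliation (p : ℕ) {X : NormalVariety k}
    (F : ∀ U : X.scheme.Opens, Set (TangentSection X U)) : Prop extends IsFoliation F where
  pow_mem : ∀ U, ∀ D ∈ F U, ∃ E ∈ F U, ∀ V hV (s : Γ(X.scheme, V)),
    E.der V hV s = (D.der V hV)^[p] s

/-- The subsheaf `f⁻¹O_Y` of `O_X`: the functions that are locally pulled back from `Y`. -/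
def inverseImageSections {X Y : NormalVariety k} (f : X ⟶ Y) (V : X.scheme.Opens) :
    Set Γ(X.scheme, V) :=
  {s | ∀ x ∈ V, ∃ (W : Y.scheme.Opens) (t : Γ(Y.scheme, W)) (V' : X.scheme.Opens)
    (h : V' ≤ V) (h' : V' ≤ (schemeMap f) ⁻¹ᵁ W),
    x ∈ V' ∧ res h s = res h' ((schemeMap f).app W t)}

/-- The foliation `F_f` attached to `f : X → Y`: the vector fields that annihilate `f⁻¹O_Y`. -/
def foliationOf {X Y : NormalVariety k} (f : X ⟶ Y) (U : X.scheme.Opens) :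
    Set (TangentSection X U) :=
  {D | ∀ V hV, ∀ s ∈ inverseImageSections f V, D.der V hV s = 0}

/-- The sheaf `A_F` of functions annihilated by `F`. -/
def annihilated {X : NormalVariety k} (F : ∀ U : X.scheme.Opens, Set (TangentSection X U))
    (U : X.scheme.Opens) : Set Γ(X.scheme, U) :=
  {s | ∀ V (h : V ≤ U), ∀ D ∈ F V, D.der V le_rfl (res h s) = 0}

/-- The `k`-morphism `g : X → Z` is the quotient of `X` by `F`, that is, it is (isomorphic to)
`X → Spec_X A_F`, where `A_F` is an `O_X`-algebra by `r • s = r ^ p * s`: there is an affine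
morphism `h : Z → X` with `h ∘ g = F_X` the absolute Frobenius, such that `g` identifies
`h_* O_Z` with the subsheaf `A_F` of `(F_X)_* O_X`. -/
def IsQuotientBy (p : ℕ) [Fact p.Prime] [CharP k p] {X Z : NormalVariety k}
    (F : ∀ U : X.scheme.Opens, Set (TangentSection X U)) (g : X ⟶ Z) : Prop :=
  ∃ h : Z.scheme ⟶ X.scheme, schemeMap g ≫ h = frob p X ∧ IsAffineHom h ∧
    ∀ U : X.scheme.Opens,
      Function.Injective ((schemeMap g).app (h ⁻¹ᵁ U)) ∧
      Set.range ((schemeMap g).app (h ⁻¹ᵁ U)) = annihilated F (schemeMap g ⁻¹ᵁ h ⁻¹ᵁ U)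

end

end InsepFactor

open InsepFactor

namespace InsepFactor

/-! ### Derivations in characteristic `p` -/

/-! Write `L` for the function field of `Y` and `K` for that of `X`. The extension `K/L` is finite
and purely inseparable, so `K^(p^e) ⊆ L` for some `e`. The subfield `M = L·K^p` generated by `L` and
the `p`-th powers is the function field of the normalization `Z` of `Y` in `M`, a normal variety
between `X` and `Y` (`exists_intermediate_normalVariety`). Since `K^p ⊆ M`, the step `X → Z` has
height one. If `K^(p^(e+1)) ⊆ L`, then `M^(p^e) ⊆ L` (`pow_mem_of_mem_closure`), so induction on `e`
applies to `Z → Y`.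

The foliations fit because a derivation kills `p`-th powers: killing `L` is the same as killing `M`,
so `X → Y` and `X → Z` have the same foliation (`foliationOf_comp`). That `Z` is the quotient by it
is a Galois-type statement. If `K^p ⊆ M`, the common kernel of the `M`-derivations of `K` is `M`
(`exists_derivation_apply_ne_zero`). Such derivations become vector fields after clearing
denominators, so a function killed by the foliation is rational on `Z`, and it is regular there
because `Z` is normal (`range_app_eq_annihilated`).

Normality also turns `p`-th powers of functions on `X` into functions on `Z`. This makes `X → Z` a
homeomorphism and produces the map `Z → X` factoring the Frobenius (`exists_frobenius_factor`). -/

open Polynomial IntermediateField in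
/-- In an extension of fields of characteristic `p` that contains all `p`-th powers, the elements
killed by all derivations are those of the base field. -/
lemma exists_derivation_apply_ne_zero (p : ℕ) [hp : Fact p.Prime] {L K : Type u} [Field L]
    [Field K] [Algebra L K] [CharP L p] [FiniteDimensional L K]
    (hpow : ∀ x : K, x ^ p ∈ (algebraMap L K).range) {s : K}
    (hs : s ∉ (algebraMap L K).range) : ∃ D : Derivation L K K, D s ≠ 0 := by
  by_contra! hD
  -- `E` is maximal among the intermediate fields without `s`. The aim is to show that `K` has no
  -- nonzero `E`-derivation: then `K/E` is both separable and purely inseparable, which forces `s ∈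
  -- E`.
  obtain ⟨E, hsE, hE⟩ := (InvImage.wf (fun E : IntermediateField L K => E.toSubalgebra.toSubmodule)
    (wellFounded_gt (α := Submodule L K))).has_min
    {E | s ∉ E} ⟨⊥, by simpa [IntermediateField.mem_bot] using hs⟩
  have hpowE : ∀ x : K, ∃ c : E, (c : K) = x ^ p := fun x => by
    obtain ⟨c, hc⟩ := hpow x
    exact ⟨algebraMap L E c, hc⟩
  have : CharP E p := charP_of_injective_algebraMap (algebraMap L E).injective p
  have : CharP E[X] p := inferInstance
  have : IsPurelyInseparable E K := by
    rw [isPurelyInseparable_iff_pow_mem E p]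
    intro x
    obtain ⟨c, hc⟩ := hpowE x
    exact ⟨1, c, by simpa using hc⟩
  have hzero : ∀ D : Derivation E K K, D = 0 := by
    intro D
    ext a
    by_cases ha : a ∈ E
    · exact D.map_algebraMap (⟨a, ha⟩ : E)
    -- By maximality `s = q(a)` with `0 < deg q < deg (minpoly E a) ≤ p`. Hence `q' ≠ 0` and `q'(a)
    -- ≠ 0`, and `0 = D s = q'(a) * D a` gives `D a = 0`.
    have hmem : s ∈ E⟮a⟯ := by
      by_contra hcon
      refine hE (E⟮a⟯.restrictScalars L) hcon ?_
      rw [InvImage, SetLike.lt_iff_le_and_exists]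
      exact ⟨fun x hx => E⟮a⟯.algebraMap_mem ⟨x, hx⟩,
        a, IntermediateField.mem_adjoin_simple_self E a, ha⟩
    have hintg : _root_.IsIntegral E a := Algebra.IsIntegral.isIntegral a
    rw [← IntermediateField.mem_toSubalgebra,
      IntermediateField.adjoin_simple_toSubalgebra_of_isAlgebraic hintg.isAlgebraic,
      Algebra.adjoin_singleton_eq_range_aeval] at hmem
    obtain ⟨q₀, hq₀ : aeval a q₀ = s⟩ := hmem
    set m := minpoly E a with hm
    have hmon : m.Monic := minpoly.monic hintg
    set q := q₀ %ₘ m with hq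
    have hqs : aeval a q = s := by
      rw [hq, aeval_modByMonic_eq_self_of_root (minpoly.aeval E a), hq₀]
    have hqdeg : q.natDegree < m.natDegree :=
      natDegree_modByMonic_lt _ hmon (minpoly.ne_one E a)
    have hmp : m.natDegree ≤ p := by
      obtain ⟨c, hc⟩ := hpowE a
      have hdvd : m ∣ X ^ p - C c := minpoly.dvd E a (by simp [← hc])
      simpa [natDegree_X_pow_sub_C] using
        natDegree_le_of_dvd hdvd (X_pow_sub_C_ne_zero hp.out.pos c)
    have hqpos : q.natDegree ≠ 0 := by
      intro h0
      rw [eq_C_of_natDegree_eq_zero h0, aeval_C] at hqs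
      exact hsE (hqs ▸ (q.coeff 0).2)
    have hder : derivative q ≠ 0 := by
      intro h0
      have h1 := congrArg (fun r => coeff r (q.natDegree - 1)) h0
      simp only [coeff_derivative, coeff_zero] at h1
      rw [Nat.sub_add_cancel (Nat.one_le_iff_ne_zero.mpr hqpos), ← Nat.cast_succ,
        Nat.succ_eq_add_one, Nat.sub_add_cancel (Nat.one_le_iff_ne_zero.mpr hqpos)] at h1
      rcases mul_eq_zero.mp h1 with h2 | h2
      · exact hqpos (by rw [leadingCoeff_eq_zero.mp h2, natDegree_zero])
      · rw [CharP.cast_eq_zero_iff E p] at h2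
        exact absurd (Nat.le_of_dvd (Nat.pos_of_ne_zero hqpos) h2) (by omega)
    have hq' : aeval a (derivative q) ≠ 0 := by
      intro h0
      have : m.natDegree ≤ _ := natDegree_le_of_dvd (minpoly.dvd E a h0) hder
      have := natDegree_derivative_lt hqpos
      omega
    have h1 : aeval a (derivative q) * D a = 0 := by
      have := D.map_aeval q a
      rw [hqs] at this
      rw [← smul_eq_mul, ← this]
      exact hD (D.restrictScalars L)
    exact (mul_eq_zero.mp h1).resolve_left hq'
  have hΩ : Subsingleton (Ω[K⁄E]) := by
    rw [← Module.subsingleton_dual_iff K]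
    refine ⟨fun φ ψ => (KaehlerDifferential.linearMapEquivDerivation E K).injective ?_⟩
    rw [hzero (KaehlerDifferential.linearMapEquivDerivation E K φ),
      hzero (KaehlerDifferential.linearMapEquivDerivation E K ψ)]
  have : Algebra.FormallyUnramified E K := ⟨hΩ⟩
  have : Algebra.IsSeparable E K := Algebra.FormallyUnramified.isSeparable E K
  obtain ⟨c, hc⟩ := IsPurelyInseparable.surjective_algebraMap_of_isSeparable E K s
  exact hsE (hc ▸ c.2)

/-- The `n`-fold composition of a derivation satisfies the higher Leibniz rule. -/
lemma iterate_derivation_mul {A : Type*} [CommRing A] (D : Derivation ℤ A A) (n : ℕ) (a b : A) :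
    D^[n] (a * b) =
      ∑ ij ∈ Finset.HasAntidiagonal.antidiagonal n, n.choose ij.1 • (D^[ij.1] a * D^[ij.2] b) := by
  induction n with
  | zero => simp
  | succ n ih =>
    rw [Finset.sum_antidiagonal_choose_succ_nsmul (M := A) (fun i j => D^[i] a * D^[j] b) n,
      Function.iterate_succ_apply', ih, map_sum, ← Finset.sum_add_distrib]
    refine Finset.sum_congr rfl fun ij hij => ?_
    rw [n.choose_symm_of_eq_add (Finset.HasAntidiagonal.mem_antidiagonal.1 hij).symm, map_nsmul,
      D.leibniz, Function.iterate_succ_apply', Function.iterate_succ_apply', smul_eq_mul,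
      smul_eq_mul, mul_comm (D^[ij.2] b), smul_add]

/-- The `p`-fold composition of a derivation of a ring in which the prime `p` is zero. -/
def powDerivation (p : ℕ) [hp : Fact p.Prime] {A : Type*} [CommRing A] (hA : (p : A) = 0)
    (D : Derivation ℤ A A) : Derivation ℤ A A :=
  Derivation.mk' ((D : A →ₗ[ℤ] A) ^ p) (by
    intro a b
    have hcoe : ∀ x, ((D : A →ₗ[ℤ] A) ^ p) x = D^[p] x := fun x => Module.End.pow_apply _ _ _
    simp only [hcoe]
    rw [iterate_derivation_mul, Finset.Nat.sum_antidiagonal_eq_sum_range_succ_mk,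
      -- Only the two extreme terms survive, since `p` divides the other binomial coefficients.
      Finset.sum_range_succ, Finset.sum_eq_single_of_mem 0 (Finset.mem_range.mpr hp.out.pos)]
    · simp [mul_comm b]
    · intro i hi hi0
      obtain ⟨c, hc⟩ := hp.out.dvd_choose_self hi0 (Finset.mem_range.mp hi)
      rw [hc, ← Nat.cast_smul_eq_nsmul A, Nat.cast_mul, hA, zero_mul, zero_smul])

lemma powDerivation_apply (p : ℕ) [Fact p.Prime] {A : Type*} [CommRing A] (hA : (p : A) = 0)
    (D : Derivation ℤ A A) (a : A) : powDerivation p hA D a = D^[p] a :=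
  Module.End.pow_apply _ _ _

/-- A derivation of a domain that kills elements generating a subfield `M` of the fraction field
together with the `p`-th powers kills the elements that lie in `M`. -/
lemma derivation_apply_eq_zero_of_mem_subfield (p : ℕ) {A K : Type*} [CommRing A]
    [IsDomain A] [Field K] [Algebra A K] [IsFractionRing A K] (hA : (p : A) = 0)
    (D : Derivation ℤ A A) (L : Subfield K)
    (hL : ∀ x ∈ L, ∃ a b : A, b ≠ 0 ∧ D a = 0 ∧ D b = 0 ∧ x = algebraMap A K a / algebraMap A K b)
    (M : Subfield K) (hM : M ≤ Subfield.closure ((L : Set K) ∪ Set.range (fun x : K => x ^ p)))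
    {s : A} (hs : algebraMap A K s ∈ M) : D s = 0 := by
  let S : Subring A :=
    { carrier := {a | D a = 0}
      mul_mem' := by intro a b ha hb; simp_all
      one_mem' := by simp
      add_mem' := by intro a b ha hb; simp_all
      zero_mem' := by simp
      neg_mem' := by intro a ha; simp_all }
  -- The kernel `S` of `D` is a subring whose fractions include `L` and all `p`-th powers, hence all
  -- of `M`. So `s * b = a` with `a, b ∈ S`, and the Leibniz rule gives `D s * b = 0`.
  have hcl : (algebraMap A K s) ∈ Subfield.closure (algebraMap A K '' (S : Set A)) := by
    refine (hM.trans ?_) hs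
    rw [Subfield.closure_le]
    rintro x (hx | ⟨y, rfl⟩)
    · obtain ⟨a, b, -, ha, hb, rfl⟩ := hL x hx
      exact div_mem (Subfield.subset_closure ⟨a, ha, rfl⟩) (Subfield.subset_closure ⟨b, hb, rfl⟩)
    · obtain ⟨a, b, -, rfl⟩ := IsFractionRing.div_surjective (A := A) y
      have key : ∀ a : A, D (a ^ p) = 0 := fun a => by
        rw [D.leibniz_pow, ← Nat.cast_smul_eq_nsmul A, hA, zero_smul]
      simp only [div_pow, ← map_pow]
      exact div_mem (Subfield.subset_closure ⟨_, key a, rfl⟩)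
        (Subfield.subset_closure ⟨_, key b, rfl⟩)
  rw [Subfield.mem_closure_iff] at hcl
  obtain ⟨y, hy, z, hz, hyz⟩ := hcl
  have him : Subring.closure (algebraMap A K '' (S : Set A)) = S.map (algebraMap A K) := by
    rw [← RingHom.map_closure, Subring.closure_eq]
  rw [him] at hy hz
  obtain ⟨a, ha, rfl⟩ := hy
  obtain ⟨b, hb, rfl⟩ := hz
  have ha' : D a = 0 := ha
  have hb' : D b = 0 := hb
  by_cases hb0 : b = 0
  · have : s = 0 := by
      apply IsFractionRing.injective A K
      rw [← hyz, hb0]; simp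
    simp [this]
  have h : s * b = a := by
    apply IsFractionRing.injective A K
    have : algebraMap A K b ≠ 0 := by simpa using hb0
    rw [map_mul, ← hyz, div_mul_cancel₀ _ this]
  have h2 := congrArg D h
  rw [D.leibniz, hb', ha', smul_zero, zero_add, smul_eq_mul] at h2
  exact (mul_eq_zero.mp h2).resolve_left hb0

/-! ### Sections of integral schemes as rational functions -/

lemma nonempty_preimage {X Y : Scheme.{u}} (f : X ⟶ Y) (hf : Surjective f) (U : Y.Opens)
    [hU : Nonempty U] : Nonempty (f ⁻¹ᵁ U : X.Opens) := by
  obtain ⟨y, hy⟩ := hU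
  obtain ⟨x, rfl⟩ := hf.surj y
  exact ⟨⟨x, hy⟩⟩

section Integral

variable {X Y : Scheme.{u}} [IsIntegral X] [IsIntegral Y]

lemma germToFunctionField_map {U V : X.Opens} (h : V ≤ U) [Nonempty U] [Nonempty V]
    (s : Γ(X, U)) : X.germToFunctionField V (X.presheaf.map (homOfLE h).op s) =
      X.germToFunctionField U s :=
  X.presheaf.germ_res_apply (homOfLE h) _ _ s

lemma functionFieldMap_germToFunctionField (f : X ⟶ Y) (hf : Surjective f) (U : Y.Opens)
    [Nonempty U] [Nonempty (f ⁻¹ᵁ U : X.Opens)] (t : Γ(Y, U)) :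
    functionFieldMap f hf (Y.germToFunctionField U t) =
      X.germToFunctionField (f ⁻¹ᵁ U) (f.app U t) := by
  simp only [functionFieldMap, CommRingCat.hom_comp, RingHom.comp_apply]
  erw [TopCat.Presheaf.germ_stalkSpecializes_apply]
  exact Scheme.Hom.germ_stalkMap_apply f U _ _ t

lemma functionFieldMap_comp {Z : Scheme.{u}} [IsIntegral Z] (f : X ⟶ Y) (hf : Surjective f)
    (g : Y ⟶ Z) (hg : Surjective g) (hfg : Surjective (f ≫ g)) (z : Z.functionField) :
    functionFieldMap (f ≫ g) hfg z = functionFieldMap f hf (functionFieldMap g hg z) := by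
  obtain ⟨U, hU, t, rfl⟩ := Z.presheaf.exists_germ_eq z
  have : Nonempty U := ⟨⟨_, hU⟩⟩
  have := nonempty_preimage g hg U
  have := nonempty_preimage f hf (g ⁻¹ᵁ U)
  have : Nonempty ((f ≫ g) ⁻¹ᵁ U : X.Opens) := this
  have h1 := functionFieldMap_germToFunctionField (f ≫ g) hfg U t
  have h2 := functionFieldMap_germToFunctionField g hg U t
  have h3 := functionFieldMap_germToFunctionField f hf (g ⁻¹ᵁ U) (g.app U t)
  refine h1.trans ?_
  refine Eq.trans ?_ (congrArg (functionFieldMap f hf) h2.symm)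
  rw [h3, Scheme.Hom.comp_app]
  rfl

/-- A rational function that is regular locally on `U` is regular on `U`. -/
lemma exists_germToFunctionField_eq_of_local (U : X.Opens) [hU : Nonempty U] (x : X.functionField)
    (h : ∀ y ∈ U, ∃ (V : X.Opens) (_ : Nonempty V) (s : Γ(X, V)),
      y ∈ V ∧ X.germToFunctionField V s = x) :
    ∃ s : Γ(X, U), X.germToFunctionField U s = x := by
  choose V hV s hy hs using h
  let W : U → X.Opens := fun y => V y.1 y.2 ⊓ U
  let r : ∀ y : U, Γ(X, W y) := fun y =>
    X.presheaf.map (homOfLE (inf_le_left : W y ≤ V y.1 y.2)).op (s y.1 y.2)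
  have hW : ∀ y, Nonempty (W y) := fun y => ⟨⟨y.1, hy y.1 y.2, y.2⟩⟩
  have hr : ∀ y, X.germToFunctionField (W y) (r y) = x := fun y =>
    (germToFunctionField_map _ _).trans (hs y.1 y.2)
  have hcompat : TopCat.Presheaf.IsCompatible X.sheaf.obj W r := by
    intro y z
    have hyz : Nonempty (W y ⊓ W z : X.Opens) :=
      ⟨⟨genericPoint X, ((genericPoint_spec X).mem_open_set_iff (W y).isOpen).mpr (by
        simpa using hW y), ((genericPoint_spec X).mem_open_set_iff (W z).isOpen).mpr (by
        simpa using hW z)⟩⟩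
    apply X.germToFunctionField_injective (W y ⊓ W z)
    exact ((germToFunctionField_map inf_le_left (r y)).trans (hr y)).trans
      ((germToFunctionField_map inf_le_right (r z)).trans (hr z)).symm
  obtain ⟨t, ht, -⟩ := X.sheaf.existsUnique_gluing' W U (fun y => homOfLE inf_le_right)
    (fun y hy' => by
      exact Opens.mem_iSup.mpr ⟨⟨y, hy'⟩, hy y hy', hy'⟩) r hcompat
  refine ⟨t, ?_⟩
  have y : U := hU.some
  rw [← hr y, ← ht y]
  exact (germToFunctionField_map inf_le_right t).symm

/-- On a normal scheme a rational function that is integral over the functions on `U` is regular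
on `U`. -/
lemma exists_germToFunctionField_eq_of_isIntegral
    (hX : ∀ x : X, IsIntegrallyClosed (X.presheaf.stalk x)) (U : X.Opens) [Nonempty U]
    (x : X.functionField)
    (h : ∀ y ∈ U, ∃ (V : X.Opens) (_ : Nonempty V), y ∈ V ∧ _root_.IsIntegral Γ(X, V) x) :
    ∃ s : Γ(X, U), X.germToFunctionField U s = x := by
  refine exists_germToFunctionField_eq_of_local U x fun y hy => ?_
  obtain ⟨V, hV, hyV, hx⟩ := h y hy
  let := TopCat.Presheaf.algebra_section_stalk X.presheaf (⟨y, hyV⟩ : V)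
  have := functionField_isScalarTower X V ⟨y, hyV⟩
  have hintg : _root_.IsIntegral (X.presheaf.stalk y) x :=
    IsIntegral.tower_top (R := Γ(X, V)) (A := X.presheaf.stalk (⟨y, hyV⟩ : V).1) hx
  have := hX y
  obtain ⟨a, rfl⟩ := IsIntegrallyClosed.algebraMap_eq_of_integral hintg
  obtain ⟨W, hyW, s, rfl⟩ := X.presheaf.exists_germ_eq a
  have : Nonempty W := ⟨⟨y, hyW⟩⟩
  exact ⟨W, inferInstance, s, hyW, (X.algebraMap_germ_eq_germToFunctionField hyW s).symm⟩

/-- If `X → Y` is integral and `Y` is normal, then a function on `X` that is rational on `Y` is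
a function on `Y`. -/
lemma mem_range_app_of_germ_mem_range (f : X ⟶ Y) [IsIntegralHom f] (hf : Surjective f)
    (hY : ∀ y : Y, IsIntegrallyClosed (Y.presheaf.stalk y)) (V : Y.Opens) [Nonempty V]
    [Nonempty (f ⁻¹ᵁ V : X.Opens)] (s : Γ(X, f ⁻¹ᵁ V))
    (hs : X.germToFunctionField (f ⁻¹ᵁ V) s ∈ (functionFieldMap f hf).range) :
    s ∈ Set.range (f.app V) := by
  obtain ⟨l, hl⟩ := hs
  obtain ⟨t, rfl⟩ := exists_germToFunctionField_eq_of_isIntegral hY V l (by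
    intro y hy
    obtain ⟨_, ⟨W, hW, rfl⟩, hyW, hWV⟩ :=
      Y.isBasis_affineOpens.exists_subset_of_mem_open hy V.isOpen
    have hWne : Nonempty W := ⟨⟨y, hyW⟩⟩
    have := nonempty_preimage f hf W
    refine ⟨W, hWne, hyW, ?_⟩
    have hWV' : f ⁻¹ᵁ W ≤ f ⁻¹ᵁ V := f.preimage_mono hWV
    -- An integral equation of `s` over the functions on `W` descends to `l`, because the map of
    -- function fields is injective.
    obtain ⟨q, hq, hq0⟩ := f.isIntegral_app W hW (X.presheaf.map (homOfLE hWV').op s)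
    refine ⟨q, hq, (functionFieldMap f hf).injective ?_⟩
    rw [map_zero, Polynomial.hom_eval₂, hl, ← germToFunctionField_map hWV']
    have hcomp : (functionFieldMap f hf).comp (algebraMap Γ(Y, W) Y.functionField) =
        (X.germToFunctionField (f ⁻¹ᵁ W)).hom.comp (f.app W).hom :=
      RingHom.ext (functionFieldMap_germToFunctionField f hf W)
    rw [hcomp]
    have := congrArg (X.germToFunctionField (f ⁻¹ᵁ W)).hom hq0
    rwa [Polynomial.hom_eval₂, map_zero] at this)
  refine ⟨t, X.germToFunctionField_injective (f ⁻¹ᵁ V) ?_⟩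
  rw [← functionFieldMap_germToFunctionField f hf, hl]

end Integral

noncomputable section

/-! ### Evaluation of functions at a morphism from an affine scheme -/

/-- The evaluation of functions on `V` at a morphism `Spec R → T` that lands in `V`. -/
def specEval {R : CommRingCat.{u}} {T : Scheme.{u}} (a : Spec R ⟶ T) (V : T.Opens)
    (h : ⊤ ≤ a ⁻¹ᵁ V) : Γ(T, V) ⟶ R :=
  a.appLE V ⊤ h ≫ (Scheme.ΓSpecIso R).hom

lemma specEval_comp {R : CommRingCat.{u}} {T S : Scheme.{u}} (a : Spec R ⟶ T) (b : T ⟶ S)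
    (V : S.Opens) (h : ⊤ ≤ (a ≫ b) ⁻¹ᵁ V) (h' : ⊤ ≤ a ⁻¹ᵁ b ⁻¹ᵁ V) :
    specEval (a ≫ b) V h = b.app V ≫ specEval a (b ⁻¹ᵁ V) h' := by
  unfold specEval
  rw [Scheme.Hom.app_eq_appLE, Scheme.Hom.appLE_comp_appLE_assoc]

lemma specEval_congr {R : CommRingCat.{u}} {T : Scheme.{u}} {a b : Spec R ⟶ T} (hab : a = b)
    (V : T.Opens) (h : ⊤ ≤ a ⁻¹ᵁ V) : specEval a V h = specEval b V (hab ▸ h) := by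
  subst hab; rfl

lemma specEval_SpecMap_comp {R S : CommRingCat.{u}} {T : Scheme.{u}} (φ : R ⟶ S) (a : Spec R ⟶ T)
    (V : T.Opens) (h : ⊤ ≤ a ⁻¹ᵁ V) (h' : ⊤ ≤ (Spec.map φ ≫ a) ⁻¹ᵁ V) :
    specEval (Spec.map φ ≫ a) V h' = specEval a V h ≫ φ := by
  have h1 : (Spec.map φ ≫ a).appLE V ⊤ h' = a.appLE V ⊤ h ≫ (Spec.map φ).appTop := by
    have h2 : (Spec.map φ).appTop = (Spec.map φ).appLE ⊤ ⊤ (by simp) :=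
      (Spec.map φ).app_eq_appLE
    rw [h2]
    exact (Scheme.Hom.appLE_comp_appLE (Spec.map φ) a V ⊤ ⊤ h (by simp)).symm
  rw [specEval, specEval, h1, Category.assoc, Category.assoc, Scheme.ΓSpecIso_naturality]

lemma specEval_fromSpecStalk {T : Scheme.{u}} (x : T) (V : T.Opens) (hx : x ∈ V)
    (h : ⊤ ≤ T.fromSpecStalk x ⁻¹ᵁ V) :
    specEval (T.fromSpecStalk x) V h = T.presheaf.germ V x hx := by
  rw [specEval, Scheme.Hom.appLE, Scheme.fromSpecStalk_app hx]
  simp only [Category.assoc, ← Functor.map_comp_assoc]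
  have : (Spec (T.presheaf.stalk x)).presheaf.map
      ((homOfLE (le_top : T.fromSpecStalk x ⁻¹ᵁ V ≤ ⊤)).op ≫ (homOfLE h).op) = 𝟙 _ :=
    (Spec (T.presheaf.stalk x)).presheaf.map_id _
  rw [this]
  simp

lemma top_le_preimage_fromSpecStalk {T : Scheme.{u}} (x : T) (V : T.Opens) (hx : x ∈ V) :
    ⊤ ≤ T.fromSpecStalk x ⁻¹ᵁ V := by
  intro z _
  have : T.fromSpecStalk x z ∈ Set.range (T.fromSpecStalk x) := ⟨z, rfl⟩
  rw [Scheme.range_fromSpecStalk] at this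
  exact this.mem_open V.isOpen hx

lemma bijective_restriction_top {R : CommRingCat.{u}} {Y : Scheme.{u}} (a : Spec R ⟶ Y)
    {U : Y.Opens} (h : ⊤ ≤ a ⁻¹ᵁ U) : Function.Bijective
    ((Spec R).presheaf.map (homOfLE h).op ≫ (Scheme.ΓSpecIso R).hom).hom := by
  have : IsIso (homOfLE h) := ⟨homOfLE le_top, rfl, rfl⟩
  exact ConcreteCategory.bijective_of_isIso
    ((Spec R).presheaf.map (homOfLE h).op ≫ (Scheme.ΓSpecIso R).hom)

/-! ### Functions on the relative normalization. -/

section Normalization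

variable {R : CommRingCat.{u}} {Y : Scheme.{u}} (a : Spec R ⟶ Y) [QuasiCompact a]
  [QuasiSeparated a]

lemma top_le_preimage_toNormalization (U : Y.Opens) (h : ⊤ ≤ a ⁻¹ᵁ U) :
    ⊤ ≤ a.toNormalization ⁻¹ᵁ a.fromNormalization ⁻¹ᵁ U := by
  rwa [← Scheme.Hom.comp_preimage, a.toNormalization_fromNormalization]

/-- Over an affine `U` the functions on the normalization are the integral closure of `Γ(Y, U)` in
the functions on `a ⁻¹ᵁ U`, and the latter ring is `R` because `a` lands in `U`. Injectivity and the
description of the image below are read off from this. -/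
lemma specEval_toNormalization_eq {U : Y.Opens} (hU : IsAffineOpen U) (h : ⊤ ≤ a ⁻¹ᵁ U) :
    letI := (a.app U).hom.toAlgebra
    specEval a.toNormalization (a.fromNormalization ⁻¹ᵁ U)
      (top_le_preimage_toNormalization a U h) =
    (a.normalizationObjIso hU).hom ≫ CommRingCat.ofHom
      (integralClosure Γ(Y, U) Γ(Spec R, a ⁻¹ᵁ U)).val.toRingHom ≫
      (Spec R).presheaf.map (homOfLE h).op ≫ (Scheme.ΓSpecIso R).hom := by
  have h1 := a.normalizationObjIso_hom_val hU
  erw [reassoc_of% h1]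
  rw [specEval, Scheme.Hom.appLE_map_assoc]

lemma specEval_toNormalization_injective {U : Y.Opens} (hU : IsAffineOpen U) (h : ⊤ ≤ a ⁻¹ᵁ U) :
    Function.Injective (specEval a.toNormalization (a.fromNormalization ⁻¹ᵁ U)
      (top_le_preimage_toNormalization a U h)).hom := by
  rw [specEval_toNormalization_eq a hU h]
  exact ((bijective_restriction_top a h).1.comp Subtype.val_injective).comp
    (ConcreteCategory.bijective_of_isIso (a.normalizationObjIso hU).hom).1

lemma mem_range_specEval_toNormalization {U : Y.Opens} (hU : IsAffineOpen U) (h : ⊤ ≤ a ⁻¹ᵁ U)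
    (x : R) : x ∈ (specEval a.toNormalization (a.fromNormalization ⁻¹ᵁ U)
      (top_le_preimage_toNormalization a U h)).hom.range ↔
        (specEval a U h).hom.IsIntegralElem x := by
  let e := ((Spec R).presheaf.map (homOfLE h).op ≫ (Scheme.ΓSpecIso R).hom).hom
  have he : Function.Bijective e := bijective_restriction_top a h
  have ha : (specEval a U h).hom = e.comp (a.app U).hom := by
    rw [← CommRingCat.hom_comp]
    rfl
  obtain ⟨y, rfl⟩ := he.2 x
  have h1 : (specEval a U h).hom.IsIntegralElem (e y) ↔ (a.app U).hom.IsIntegralElem y := by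
    rw [ha]
    refine exists_congr fun q => and_congr_right fun _ => ?_
    rw [← Polynomial.hom_eval₂, map_eq_zero_iff e he.1]
  rw [h1, specEval_toNormalization_eq a hU h]
  constructor
  · rintro ⟨c, hc⟩
    have hc' : e ((a.normalizationObjIso hU).hom c).1 = e y := hc
    rw [← he.1 hc']
    exact ((a.normalizationObjIso hU).hom c).2
  · intro hy
    let := (a.app U).hom.toAlgebra
    obtain ⟨c, hc⟩ := (ConcreteCategory.bijective_of_isIso (a.normalizationObjIso hU).hom).2
      (⟨y, hy⟩ : integralClosure Γ(Y, U) Γ(Spec R, a ⁻¹ᵁ U))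
    refine ⟨c, ?_⟩
    change e ((a.normalizationObjIso hU).hom c).1 = e y
    erw [hc]

end Normalization

/-! ### Normalization in an extension of the function field -/

section GenericMap

variable {Y : Scheme.{u}} [IsIntegral Y] {R : CommRingCat.{u}} (φ : Y.functionField ⟶ R)

/-- The morphism to an integral scheme given by an algebra over its function field. -/
def genericMap : Spec R ⟶ Y :=
  Spec.map φ ≫ Y.fromSpecStalk (genericPoint Y)

lemma genericPoint_mem (U : Y.Opens) [h : Nonempty U] : genericPoint Y ∈ U :=
  ((genericPoint_spec Y).mem_open_set_iff U.isOpen).mpr (by simpa using h)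

lemma top_le_preimage_genericMap (U : Y.Opens) [Nonempty U] : ⊤ ≤ genericMap φ ⁻¹ᵁ U := by
  rw [genericMap, Scheme.Hom.comp_preimage]
  exact fun z _ => top_le_preimage_fromSpecStalk _ U (genericPoint_mem U) trivial

lemma specEval_genericMap (U : Y.Opens) [Nonempty U] :
    specEval (genericMap φ) U (top_le_preimage_genericMap φ U) = Y.germToFunctionField U ≫ φ := by
  refine (specEval_SpecMap_comp φ _ U
      (top_le_preimage_fromSpecStalk _ U (genericPoint_mem U)) _).trans ?_
  rw [specEval_fromSpecStalk _ _ (genericPoint_mem U)]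

end GenericMap

section

variable {X Y : Scheme.{u}} [IsIntegral X] [IsIntegral Y]

/-- This commutative square is the input to the universal property of the normalization of `Y` in
the function field of `X`. -/
lemma genericMap_functionFieldMap (f : X ⟶ Y) (hf : Surjective f) :
    genericMap (CommRingCat.ofHom (functionFieldMap f hf)) =
      X.fromSpecStalk (genericPoint X) ≫ f := by
  rw [← Scheme.SpecMap_stalkMap_fromSpecStalk]
  change Spec.map (Y.presheaf.stalkSpecializes (specializes_of_eq (map_genericPoint f hf)) ≫
      f.stalkMap (genericPoint X)) ≫ _ = _
  rw [Spec.map_comp, Category.assoc, Scheme.SpecMap_stalkSpecializes_fromSpecStalk]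

/-- The normalization of `Y` in the function field of `X` maps to any integral `X` over `Y`. -/
def fromNormalizationFunctionField (f : X ⟶ Y) (hf : Surjective f) [IsIntegralHom f] :
    (genericMap (CommRingCat.ofHom (functionFieldMap f hf))).normalization ⟶ X :=
  (genericMap (CommRingCat.ofHom (functionFieldMap f hf))).normalizationDesc
    (X.fromSpecStalk (genericPoint X)) f (genericMap_functionFieldMap f hf)

/-- A normal scheme `X` that is integral over `Y` is the normalization of `Y` in the function
field of `X`. -/
lemma isIso_fromNormalizationFunctionField (f : X ⟶ Y) (hf : Surjective f) [IsIntegralHom f]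
    (hX : ∀ x : X, IsIntegrallyClosed (X.presheaf.stalk x)) :
    IsIso (fromNormalizationFunctionField f hf) := by
  set a := genericMap (CommRingCat.ofHom (functionFieldMap f hf)) with ha
  set d : a.normalization ⟶ X := fromNormalizationFunctionField f hf with hd
  have hdf : d ≫ f = a.fromNormalization := a.normalizationDesc_comp _ _ _
  have had : a.toNormalization ≫ d = X.fromSpecStalk (genericPoint X) :=
    a.toNormalization_normalizationDesc _ _ _
  have : IsIntegralHom (d ≫ f) := by rw [hdf]; infer_instance
  have : IsIntegralHom d := .of_comp d f
  apply IsZariskiLocalAtTarget.of_forall_exists_morphismRestrict (P := .isomorphisms _) fun x ↦ ?_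
  obtain ⟨_, ⟨U, hU, rfl⟩, hxU, -⟩ := Y.isBasis_affineOpens.exists_subset_of_mem_open
    (Set.mem_univ (f x)) isOpen_univ
  have hUne : Nonempty U := ⟨⟨_, hxU⟩⟩
  have hUne' : Nonempty (f ⁻¹ᵁ U : X.Opens) := ⟨⟨x, hxU⟩⟩
  refine ⟨f ⁻¹ᵁ U, hxU, (isIso_morphismRestrict_iff_isIso_app _ (hU.preimage f)).mpr ?_⟩
  have htop : ⊤ ≤ a ⁻¹ᵁ U := top_le_preimage_genericMap _ U
  have hpre : d ⁻¹ᵁ f ⁻¹ᵁ U = a.fromNormalization ⁻¹ᵁ U := by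
    rw [← Scheme.Hom.comp_preimage, hdf]
  -- The open set `V` is left variable because `d ⁻¹ᵁ f ⁻¹ᵁ U` equals `a.fromNormalization ⁻¹ᵁ U`
  -- only propositionally.
  have key : ∀ (V : a.normalization.Opens) (_ : V = a.fromNormalization ⁻¹ᵁ U)
      (h : ⊤ ≤ a.toNormalization ⁻¹ᵁ V),
      Function.Injective (specEval a.toNormalization V h).hom ∧
      ∀ c, (specEval a U htop).hom.IsIntegralElem ((specEval a.toNormalization V h).hom c) := by
    rintro _ rfl h
    exact ⟨specEval_toNormalization_injective a hU htop, fun c =>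
      (mem_range_specEval_toNormalization a hU htop _).mp ⟨c, rfl⟩⟩
  have htop' : ⊤ ≤ a.toNormalization ⁻¹ᵁ d ⁻¹ᵁ f ⁻¹ᵁ U :=
    hpre ▸ top_le_preimage_toNormalization a U htop
  obtain ⟨hinj, hintg⟩ := key _ hpre htop'
  have hcomp : d.app (f ⁻¹ᵁ U) ≫ specEval a.toNormalization _ htop' =
      X.germToFunctionField (f ⁻¹ᵁ U) := by
    have h1 : ⊤ ≤ (a.toNormalization ≫ d) ⁻¹ᵁ f ⁻¹ᵁ U := htop'
    rw [← specEval_comp a.toNormalization d _ h1, specEval_congr had,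
      specEval_fromSpecStalk _ _ (genericPoint_mem _)]
  have hcomp' : ∀ s, (specEval a.toNormalization _ htop').hom (d.app (f ⁻¹ᵁ U) s) =
      X.germToFunctionField (f ⁻¹ᵁ U) s := fun s => congr($(hcomp) s)
  rw [ConcreteCategory.isIso_iff_bijective]
  refine ⟨fun s t hst => X.germToFunctionField_injective (f ⁻¹ᵁ U) ?_, fun c => ?_⟩
  · rw [← hcomp', ← hcomp', hst]
  -- Normality of `X` enters here: a function on the normalization is a rational function on `X`
  -- integral over `Γ(Y, U)`, hence regular on `f ⁻¹ᵁ U`.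
  · obtain ⟨s, hs⟩ := exists_germToFunctionField_eq_of_isIntegral hX (f ⁻¹ᵁ U)
      ((specEval a.toNormalization _ htop').hom c) (fun y hy => ⟨f ⁻¹ᵁ U, hUne', hy, by
        obtain ⟨q, hq, hq0⟩ := hintg c
        refine ⟨q.map (f.app U).hom, hq.map _, ?_⟩
        rw [Polynomial.eval₂_map]
        convert hq0 using 2
        have he : specEval a U htop = _ := specEval_genericMap _ U
        rw [he]
        exact RingHom.ext fun t => (functionFieldMap_germToFunctionField f hf U t).symm⟩)
    exact ⟨s, hinj (by rw [hcomp', hs])⟩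

/-- If `X` is normal and integral over `Y`, then every field between the function fields of `Y`
and `X` gives a factorization of `X → Y` through the normalization of `Y` in that field. -/
lemma exists_intermediate (f : X ⟶ Y) (hf : Surjective f) [IsIntegralHom f]
    (hX : ∀ x : X, IsIntegrallyClosed (X.presheaf.stalk x)) (M : Subfield X.functionField)
    (hM : (functionFieldMap f hf).fieldRange ≤ M) :
    ∃ (Z : Scheme.{u}) (_ : IsIntegral Z) (g : X ⟶ Z) (f' : Z ⟶ Y), g ≫ f' = f ∧
      IsIntegralHom f' ∧ IsDominant g ∧
      ∀ (U : Y.Opens) (_ : IsAffineOpen U) [Nonempty U] [Nonempty (g ⁻¹ᵁ f' ⁻¹ᵁ U : X.Opens)],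
        Function.Injective ((X.germToFunctionField _).hom.comp (g.app (f' ⁻¹ᵁ U)).hom) ∧
        ∀ x, x ∈ ((X.germToFunctionField _).hom.comp (g.app (f' ⁻¹ᵁ U)).hom).range ↔
          x ∈ M ∧
          ((functionFieldMap f hf).comp (Y.germToFunctionField U).hom).IsIntegralElem x := by
  have hN : IsNoetherianRing (CommRingCat.of M) := inferInstanceAs (IsNoetherianRing M)
  let φ : Y.functionField ⟶ CommRingCat.of M := CommRingCat.ofHom
    ((functionFieldMap f hf).codRestrict M fun y => hM ⟨y, rfl⟩)
  let ψ : CommRingCat.of M ⟶ CommRingCat.of X.functionField := CommRingCat.ofHom M.subtype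
  set aK := genericMap (CommRingCat.ofHom (functionFieldMap f hf)) with haK
  set a := genericMap φ with ha
  have haaK : aK = Spec.map ψ ≫ a := by
    rw [haK, ha]
    unfold genericMap
    rw [← Spec.map_comp_assoc]
    rfl
  have hfac : aK = (Spec.map ψ ≫ a.toNormalization) ≫ a.fromNormalization := by
    rw [Category.assoc, a.toNormalization_fromNormalization, haaK]
  set d : aK.normalization ⟶ X := fromNormalizationFunctionField f hf with hd
  have hiso : IsIso d := isIso_fromNormalizationFunctionField f hf hX
  have hdf : d ≫ f = aK.fromNormalization := aK.normalizationDesc_comp _ _ _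
  have had : aK.toNormalization ≫ d = X.fromSpecStalk (genericPoint X) :=
    aK.toNormalization_normalizationDesc _ _ _
  -- `X` is identified with the normalization in its own function field, which maps to the
  -- normalization in the smaller field `M`.
  let g : X ⟶ a.normalization := inv d ≫ aK.normalizationDesc _ _ hfac
  have hIM : _root_.IsDomain (CommRingCat.of M) := inferInstanceAs (IsDomain M)
  have hgf : g ≫ a.fromNormalization = f := by
    rw [Category.assoc, aK.normalizationDesc_comp, IsIso.inv_comp_eq, hdf]
  have hgen : X.fromSpecStalk (genericPoint X) ≫ g = Spec.map ψ ≫ a.toNormalization := by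
    rw [← had, Category.assoc, IsIso.hom_inv_id_assoc, aK.toNormalization_normalizationDesc]
  have : Subsingleton (Spec (CommRingCat.of M)) := inferInstanceAs (Subsingleton (PrimeSpectrum M))
  have : Nonempty (Spec (CommRingCat.of X.functionField)) :=
    inferInstanceAs (Nonempty (PrimeSpectrum X.functionField))
  have hdom : IsDominant g := by
    have : IsDominant (X.fromSpecStalk (genericPoint X) ≫ g) := by
      rw [hgen]; infer_instance
    exact .of_comp (X.fromSpecStalk (genericPoint X)) g
  refine ⟨a.normalization, inferInstance, g, a.fromNormalization, hgf, inferInstance, hdom, ?_⟩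
  intro U hU _ _
  have htop : ⊤ ≤ a ⁻¹ᵁ U := top_le_preimage_genericMap _ U
  -- Evaluating at the generic point of `X` factors through `Spec M`, so the rational functions
  -- coming from `Z` lie in `M`.
  have hev : (X.germToFunctionField (g ⁻¹ᵁ a.fromNormalization ⁻¹ᵁ U)).hom.comp
      (g.app (a.fromNormalization ⁻¹ᵁ U)).hom =
      M.subtype.comp (specEval a.toNormalization (a.fromNormalization ⁻¹ᵁ U)
        (top_le_preimage_toNormalization a U htop)).hom := by
    have h1 : ⊤ ≤ X.fromSpecStalk (genericPoint X) ⁻¹ᵁ g ⁻¹ᵁ a.fromNormalization ⁻¹ᵁ U :=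
      top_le_preimage_fromSpecStalk _ _ (genericPoint_mem _)
    have h1' : ⊤ ≤ (X.fromSpecStalk (genericPoint X) ≫ g) ⁻¹ᵁ a.fromNormalization ⁻¹ᵁ U := h1
    have h2 := specEval_comp (X.fromSpecStalk (genericPoint X)) g (a.fromNormalization ⁻¹ᵁ U) h1' h1
    rw [specEval_fromSpecStalk _ _ (genericPoint_mem _), specEval_congr hgen] at h2
    erw [specEval_SpecMap_comp ψ a.toNormalization (a.fromNormalization ⁻¹ᵁ U)
      (top_le_preimage_toNormalization a U htop)] at h2
    exact congr($(h2.symm).hom)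
  have hevU : (specEval a U htop).hom = φ.hom.comp (Y.germToFunctionField U).hom :=
    congr($(specEval_genericMap φ U).hom)
  have hIE : ∀ m : M, ((functionFieldMap f hf).comp (Y.germToFunctionField U).hom).IsIntegralElem
      (m : X.functionField) ↔ (specEval a U htop).hom.IsIntegralElem m := by
    intro m
    have h3 : (functionFieldMap f hf).comp (Y.germToFunctionField U).hom =
      M.subtype.comp (φ.hom.comp (Y.germToFunctionField U).hom) := rfl
    rw [hevU, h3]
    refine exists_congr fun q => and_congr_right fun _ => ?_
    have h4 : (m : X.functionField) = M.subtype m := rfl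
    rw [h4, ← Polynomial.hom_eval₂, map_eq_zero_iff _ M.subtype.injective]
  rw [hev]
  refine ⟨M.subtype.injective.comp (specEval_toNormalization_injective a hU htop), fun x => ?_⟩
  constructor
  · rintro ⟨c, rfl⟩
    refine ⟨Subtype.prop _, (hIE _).mpr ?_⟩
    exact (mem_range_specEval_toNormalization a hU htop _).mp ⟨c, rfl⟩
  · rintro ⟨hx, hx'⟩
    obtain ⟨c, hc⟩ := (mem_range_specEval_toNormalization a hU htop _).mpr
      ((hIE ⟨x, hx⟩).mp hx')
    exact ⟨c, congrArg M.subtype hc⟩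

end

lemma exists_affineOpen_mem {Y : Scheme.{u}} (y : Y) : ∃ U : Y.Opens, IsAffineOpen U ∧ y ∈ U := by
  obtain ⟨_, ⟨U, hU, rfl⟩, hxU, -⟩ := Y.isBasis_affineOpens.exists_subset_of_mem_open
    (Set.mem_univ y) isOpen_univ
  exact ⟨U, hU, hxU⟩

/-! ### Finiteness, function field and normality of the intermediate scheme. -/

section

variable {X Y Z : Scheme.{u}}

/-- Since `g` is dominant and `Z` is reduced, functions on `Z` embed into functions on `X`. Over an
affine `U` they form a submodule of a finite module over the Noetherian ring `Γ(Y, U)`. -/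
lemma isFinite_of_comp_of_isDominant (g : X ⟶ Z) (f' : Z ⟶ Y) [IsIntegralHom f'] [IsFinite (g ≫ f')]
    [IsDominant g] [IsReduced Z] [IsLocallyNoetherian Y] : IsFinite f' := by
  have : IsFinite g := .of_comp g f'
  have : IsSchemeTheoreticallyDominant g := .of_isDominant g
  refine { finite_app := fun U hU => ?_ }
  have := IsLocallyNoetherian.component_noetherian ⟨U, hU⟩
  have h1 : ((g.app (f' ⁻¹ᵁ U)).hom.comp (f'.app U).hom).Finite := by
    have h2 := (g ≫ f').finite_app U hU
    rw [Scheme.Hom.comp_app] at h2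
    exact h2
  algebraize [(f'.app U).hom, (g.app (f' ⁻¹ᵁ U)).hom, (g.app (f' ⁻¹ᵁ U)).hom.comp (f'.app U).hom]
  exact Module.Finite.of_injective
    (IsScalarTower.toAlgHom Γ(Y, U) Γ(Z, f' ⁻¹ᵁ U) Γ(X, g ⁻¹ᵁ f' ⁻¹ᵁ U)).toLinearMap
    (g.app_injective _)

lemma germToFunctionField_eq_functionFieldMap [IsIntegral X] [IsIntegral Z] (g : X ⟶ Z)
    (hg : Surjective g) (V : Z.Opens) [Nonempty V] [Nonempty (g ⁻¹ᵁ V : X.Opens)] :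
    (X.germToFunctionField (g ⁻¹ᵁ V)).hom.comp (g.app V).hom =
      (functionFieldMap g hg).comp (Z.germToFunctionField V).hom :=
  RingHom.ext fun t => (functionFieldMap_germToFunctionField g hg V t).symm

variable [IsIntegral X] [IsIntegral Y] [IsIntegral Z]

/-- The function field of the normalization of `Y` in a field `M` is `M`. -/
lemma fieldRange_functionFieldMap_eq (g : X ⟶ Z) (f' : Z ⟶ Y) [IsIntegralHom f']
    (hf : Surjective (g ≫ f')) (hg : Surjective g) (hf' : Surjective f')
    (M : Subfield X.functionField) (hM : (functionFieldMap (g ≫ f') hf).fieldRange ≤ M)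
    (halg : ∀ x ∈ M, ∃ n > 0, x ^ n ∈ (functionFieldMap (g ≫ f') hf).range)
    (h : ∀ (U : Y.Opens) (_ : IsAffineOpen U) [Nonempty U]
      [Nonempty (g ⁻¹ᵁ f' ⁻¹ᵁ U : X.Opens)],
        ∀ x, x ∈ ((X.germToFunctionField _).hom.comp (g.app (f' ⁻¹ᵁ U)).hom).range ↔
          x ∈ M ∧ ((functionFieldMap (g ≫ f') hf).comp
            (Y.germToFunctionField U).hom).IsIntegralElem x) :
    (functionFieldMap g hg).fieldRange = M := by
  obtain ⟨U, hU, hyU⟩ := exists_affineOpen_mem (genericPoint Y)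
  have : Nonempty U := ⟨⟨_, hyU⟩⟩
  have := nonempty_preimage f' hf' U
  have := nonempty_preimage g hg (f' ⁻¹ᵁ U)
  have hVaff : IsAffineOpen (f' ⁻¹ᵁ U) := hU.preimage f'
  have hUx := h U hU
  rw [germToFunctionField_eq_functionFieldMap g hg] at hUx
  have := functionField_isFractionRing_of_isAffineOpen Z _ hVaff
  have := functionField_isFractionRing_of_isAffineOpen Y _ hU
  apply le_antisymm
  · rintro _ ⟨z, rfl⟩
    obtain ⟨c, c', -, rfl⟩ := IsFractionRing.div_surjective (A := Γ(Z, f' ⁻¹ᵁ U)) z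
    rw [map_div₀]
    exact div_mem ((hUx _).mp ⟨c, rfl⟩).1 ((hUx _).mp ⟨c', rfl⟩).1
  · intro m hm
    obtain ⟨n, hn, l, hl⟩ := halg m hm
    obtain ⟨b, b', hb', rfl⟩ := IsFractionRing.div_surjective (A := Γ(Y, U)) l
    set ρ := (functionFieldMap (g ≫ f') hf).comp (Y.germToFunctionField U).hom with hρ
    have hρb' : ρ b' ≠ 0 := by
      rw [hρ, RingHom.comp_apply, map_ne_zero]
      exact IsFractionRing.to_map_ne_zero_of_mem_nonZeroDivisors hb'
    have hl' : m ^ n = ρ b / ρ b' := by rw [← hl, map_div₀]; rfl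
    -- Clearing the denominator of `m ^ n = b / b'`: the `n`-th power of `b' * m` comes from `Γ(Y,
    -- U)`, so `b' * m` is integral and `m` is a quotient of functions on `Z`.
    have hxn : (ρ b' * m) ^ n = ρ (b' ^ (n - 1) * b) := by
      obtain ⟨n, rfl⟩ := Nat.exists_eq_add_of_lt hn
      rw [mul_pow, hl']
      simp only [zero_add, add_tsub_cancel_right, map_mul, map_pow]
      field_simp
      ring
    have hintg : ρ.IsIntegralElem (ρ b' * m) := by
      let := ρ.toAlgebra
      exact IsIntegral.of_pow (R := Γ(Y, U)) hn (hxn ▸ isIntegral_algebraMap)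
    have hρM : ρ b' ∈ M := hM ⟨_, rfl⟩
    obtain ⟨c, hc⟩ := (hUx _).mpr ⟨mul_mem hρM hm, hintg⟩
    have : m = (ρ b' * m) / ρ b' := by field_simp
    rw [this]
    refine div_mem ⟨_, hc⟩ ⟨functionFieldMap f' hf' (Y.germToFunctionField U b'), ?_⟩
    rw [← functionFieldMap_comp g hg f' hf' hf]
    rfl

/-- The normalization of `Y` in a field `M` is normal. -/
lemma isIntegrallyClosed_stalk_of_range (g : X ⟶ Z) (f' : Z ⟶ Y) [IsIntegralHom f']
    (hf : Surjective (g ≫ f')) (hg : Surjective g) (hf' : Surjective f')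
    (M : Subfield X.functionField) (hM : (functionFieldMap g hg).fieldRange ≤ M)
    (h : ∀ (U : Y.Opens) (_ : IsAffineOpen U) [Nonempty U]
      [Nonempty (g ⁻¹ᵁ f' ⁻¹ᵁ U : X.Opens)],
        ∀ x, x ∈ ((X.germToFunctionField _).hom.comp (g.app (f' ⁻¹ᵁ U)).hom).range ↔
          x ∈ M ∧ ((functionFieldMap (g ≫ f') hf).comp
            (Y.germToFunctionField U).hom).IsIntegralElem x) (z : Z) :
    IsIntegrallyClosed (Z.presheaf.stalk z) := by
  obtain ⟨U, hU, hyU⟩ := exists_affineOpen_mem (f' z)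
  have : Nonempty U := ⟨⟨_, hyU⟩⟩
  have := nonempty_preimage f' hf' U
  have := nonempty_preimage g hg (f' ⁻¹ᵁ U)
  have hVaff : IsAffineOpen (f' ⁻¹ᵁ U) := hU.preimage f'
  have hUx := h U hU
  rw [germToFunctionField_eq_functionFieldMap g hg] at hUx
  have := functionField_isFractionRing_of_isAffineOpen Z _ hVaff
  have hC : IsIntegrallyClosed Γ(Z, f' ⁻¹ᵁ U) := by
    rw [isIntegrallyClosed_iff Z.functionField]
    intro x hx
    -- By transitivity `x` is integral over `Γ(Y, U)`. It also lies in `M`, so it is one of the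
    -- functions described by `h`.
    have hx' : ((functionFieldMap (g ≫ f') hf).comp
        (Y.germToFunctionField U).hom).IsIntegralElem (functionFieldMap g hg x) := by
      let := (f'.app U).hom.toAlgebra
      let := ((Z.germToFunctionField (f' ⁻¹ᵁ U)).hom.comp (f'.app U).hom).toAlgebra
      have : IsScalarTower Γ(Y, U) Γ(Z, f' ⁻¹ᵁ U) Z.functionField := .of_algebraMap_eq' rfl
      have : Algebra.IsIntegral Γ(Y, U) Γ(Z, f' ⁻¹ᵁ U) := ⟨f'.isIntegral_app U hU⟩
      obtain ⟨q, hq, hq0⟩ := isIntegral_trans (R := Γ(Y, U)) x hx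
      refine ⟨q, hq, ?_⟩
      have := congrArg (functionFieldMap g hg) hq0
      rw [Polynomial.hom_eval₂, map_zero] at this
      have hcomp : (functionFieldMap (g ≫ f') hf).comp (Y.germToFunctionField U).hom =
          (functionFieldMap g hg).comp (algebraMap Γ(Y, U) Z.functionField) := by
        refine RingHom.ext fun t => ?_
        rw [RingHom.comp_apply, functionFieldMap_comp g hg f' hf' hf]
        exact congrArg (functionFieldMap g hg) (functionFieldMap_germToFunctionField f' hf' U t)
      rwa [hcomp]
    obtain ⟨c, hc⟩ := (hUx _).mpr ⟨hM ⟨x, rfl⟩, hx'⟩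
    exact ⟨c, (functionFieldMap g hg).injective hc⟩
  let := TopCat.Presheaf.algebra_section_stalk Z.presheaf (⟨z, hyU⟩ : (f' ⁻¹ᵁ U : Z.Opens))
  have := hVaff.isLocalization_stalk ⟨z, hyU⟩
  exact isIntegrallyClosed_of_isLocalization _ _ (Ideal.primeCompl_le_nonZeroDivisors
    (hVaff.primeIdealOf ⟨z, hyU⟩).asIdeal)

end

/-- Every field between the function fields of normal varieties `Y` and `X`, where `X → Y` is finite
with an extension of function fields in which every element has a power in the base, is the
function field of a normal variety between `X` and `Y`. -/
lemma exists_intermediate_normalVariety {k : Type u} [Field k] {X Y : NormalVariety k} (f : X ⟶ Y)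
    (hf : Surjective (schemeMap f)) [IsFinite (schemeMap f)] (M : Subfield X.scheme.functionField)
    (hM : (functionFieldMap (schemeMap f) hf).fieldRange ≤ M)
    (halg : ∀ x ∈ M, ∃ n > 0, x ^ n ∈ (functionFieldMap (schemeMap f) hf).range) :
    ∃ (Z : NormalVariety k) (g : X ⟶ Z) (f' : Z ⟶ Y), g ≫ f' = f ∧ IsFinite (schemeMap g) ∧
      IsFinite (schemeMap f') ∧ Surjective (schemeMap f') ∧ ∃ hg : Surjective (schemeMap g),
        (functionFieldMap (schemeMap g) hg).fieldRange = M := by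
  obtain ⟨Z, hZ, g, f', hgf, _, _, h⟩ :=
    exists_intermediate (schemeMap f) hf X.property.normal M hM
  have : IsLocallyNoetherian Y.scheme := by
    have := Y.property.locallyOfFiniteType
    exact LocallyOfFiniteType.isLocallyNoetherian Y.obj.hom
  have := Y.property.isSeparated
  have := Y.property.locallyOfFiniteType
  have := Y.property.quasiCompact
  have hfin : IsFinite (g ≫ f') := hgf ▸ inferInstance
  have hgfin : IsFinite g := .of_comp g f'
  have hg : Surjective g :=
    surjective_of_isDominant_of_isClosed_range g g.isClosedMap.isClosed_range
  have hgf' : Surjective (g ≫ f') := hgf ▸ hf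
  have hf' : Surjective f' := .of_comp g f'
  have hf'fin : IsFinite f' := isFinite_of_comp_of_isDominant g f'
  have hM' : functionFieldMap (g ≫ f') hgf' = functionFieldMap (schemeMap f) hf := by
    congr 1
  have h' : (functionFieldMap g hg).fieldRange = M := by
    refine fieldRange_functionFieldMap_eq g f' hgf' hg hf' M (hM' ▸ hM) (hM' ▸ halg) ?_
    intro U hU _ _ x
    rw [hM']
    exact (h U hU).2 x
  have hnormal : ∀ z : Z, IsIntegrallyClosed (Z.presheaf.stalk z) :=
    isIntegrallyClosed_stalk_of_range g f' hgf' hg hf' M h'.le (by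
      intro U hU _ _ x
      rw [hM']
      exact (h U hU).2 x)
  let Z' : NormalVariety k := ⟨Over.mk (f' ≫ Y.obj.hom),
    { isIntegral := hZ
      isSeparated := inferInstanceAs (IsSeparated (f' ≫ Y.obj.hom))
      locallyOfFiniteType := inferInstanceAs (LocallyOfFiniteType (f' ≫ Y.obj.hom))
      quasiCompact := inferInstanceAs (QuasiCompact (f' ≫ Y.obj.hom))
      normal := hnormal }⟩
  refine ⟨Z', ⟨Over.homMk g (by
    change g ≫ f' ≫ Y.obj.hom = X.obj.hom
    rw [← Category.assoc, hgf]
    exact Over.w f.hom)⟩, ⟨Over.homMk f' rfl⟩, ?_, hgfin, hf'fin, hf', hg, h'⟩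
  ext
  exact hgf

/-! ### Factoring the Frobenius -/

section

variable {X Y : Scheme.{u}}

/-- An affine surjective morphism such that every function on the source has a power that comes
from the target is a homeomorphism. -/
lemma isHomeomorph_of_forall_exists_pow (f : X ⟶ Y) [IsAffineHom f] (hf : Surjective f) {p : ℕ}
    (hp : 0 < p)
    (H : ∀ (V : Y.Opens) (s : Γ(X, f ⁻¹ᵁ V)), ∃ t : Γ(Y, V), f.app V t = s ^ p) :
    IsHomeomorph f := by
  have hopen : ∀ W : X.Opens, ∃ V : Y.Opens, f ⁻¹ᵁ V = W := by
    intro W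
    have hloc : ∀ x ∈ W, ∃ V : Y.Opens, x ∈ f ⁻¹ᵁ V ∧ f ⁻¹ᵁ V ≤ W := by
      intro x hx
      obtain ⟨U, hU, hxU⟩ := exists_affineOpen_mem (f x)
      obtain ⟨s, hs, hxs⟩ := (hU.preimage f).exists_basicOpen_le ⟨x, hx⟩ hxU
      obtain ⟨t, ht⟩ := H U s
      -- A section and its `p`-th power have the same basic open set, so small opens of `X` are
      -- preimages from `Y`.
      have : f ⁻¹ᵁ Y.basicOpen t = X.basicOpen s := by
        rw [Scheme.preimage_basicOpen, ht, X.basicOpen_pow _ hp]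
      exact ⟨Y.basicOpen t, this ▸ hxs, this ▸ hs⟩
    choose V hV hV' using hloc
    refine ⟨⨆ x : W, V x.1 x.2, le_antisymm ?_ fun x hx => ?_⟩
    · rw [Scheme.Hom.preimage_iSup]
      exact iSup_le fun x => hV' _ _
    · exact Opens.mem_iSup.mpr ⟨⟨x, hx⟩, hV x hx⟩
  have hind : Topology.IsInducing f := by
    refine ⟨le_antisymm f.continuous.le_induced fun W hW => ?_⟩
    obtain ⟨V, hV⟩ := hopen ⟨W, hW⟩
    exact ⟨V, V.isOpen, congrArg SetLike.coe hV⟩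
  exact (hind.isEmbedding.toHomeomorphOfSurjective hf.surj).isHomeomorph

lemma preimage_map_le (f : X ⟶ Y) (e : (Y : TopCat) ⟶ (X : TopCat)) (he : ∀ x : X, e (f x) = x)
    (U : X.Opens) : f ⁻¹ᵁ ((Opens.map e).obj U) ≤ U := by
  intro x hx
  have hx' : e (f x) ∈ U := hx
  rwa [he] at hx'

variable (f : X ⟶ Y) {p : ℕ} [hp : Fact p.Prime] (hX : (p : Γ(X, ⊤)) = 0)
  (hinj : ∀ V : Y.Opens, Function.Injective (f.app V))
  (H : ∀ (V : Y.Opens) (s : Γ(X, f ⁻¹ᵁ V)), ∃ t : Γ(Y, V), f.app V t = s ^ p)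

/-- The function on `Y` that pulls back to the `p`-th power of a function on `X`. -/
def frobeniusDescent (V : Y.Opens) : Γ(X, f ⁻¹ᵁ V) →+* Γ(Y, V) where
  toFun s := (H V s).choose
  map_one' := hinj V (by rw [(H V 1).choose_spec, one_pow, map_one])
  map_mul' s t := hinj V (by
    rw [map_mul, (H V s).choose_spec, (H V t).choose_spec, (H V (s * t)).choose_spec, mul_pow])
  map_zero' := hinj V (by
    rw [(H V 0).choose_spec, zero_pow hp.out.ne_zero, map_zero])
  map_add' s t := hinj V (by
    rw [map_add, (H V s).choose_spec, (H V t).choose_spec, (H V (s + t)).choose_spec]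
    exact map_add (powHom p Γ(X, f ⁻¹ᵁ V) (natCast_sections_eq_zero p X hX _)) s t)

lemma app_frobeniusDescent (V : Y.Opens) (s : Γ(X, f ⁻¹ᵁ V)) :
    f.app V (frobeniusDescent f hX hinj H V s) = s ^ p :=
  (H V s).choose_spec

variable (e : (Y : TopCat) ⟶ (X : TopCat)) (he : ∀ x : X, e (f x) = x)

/-- The morphism of ringed spaces that factors the Frobenius through a homeomorphism. -/
def frobeniusFactorHom : Y.toPresheafedSpace ⟶ X.toPresheafedSpace where
  base := e
  c :=
    { app := fun U => CommRingCat.ofHom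
        ((frobeniusDescent f hX hinj H ((Opens.map e).obj U.unop)).comp
          (X.presheaf.map (homOfLE (preimage_map_le f e he U.unop)).op).hom)
      naturality := by
        intro U V i
        ext s
        -- Compared on `X`, both sides are the `p`-th power of the same restriction of `s`.
        apply hinj
        have h1 := f.naturality ((Opens.map e).map i.unop).op
        have h2 := fun t => congr($(h1) t)
        simp only [CommRingCat.comp_apply] at h2
        simp only [CommRingCat.hom_comp, CommRingCat.hom_ofHom, RingHom.comp_apply]
        refine (app_frobeniusDescent f hX hinj H _ _).trans ?_
        refine Eq.trans ?_ (h2 _).symm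
        erw [app_frobeniusDescent f hX hinj H]
        rw [map_pow]
        congr 1
        simp only [← CommRingCat.comp_apply, ← Functor.map_comp]
        rfl }

/-- This gives locality of the factoring morphism on stalks: pulled back along `f`, the given unit
becomes the `p`-th power of the germ of `s`. -/
lemma isUnit_germ_frobeniusDescent (U : X.Opens) (s : Γ(X, U)) (x : X) (hx : x ∈ U)
    (hx' : f x ∈ (Opens.map e).obj U)
    (h : IsUnit (Y.presheaf.germ ((Opens.map e).obj U) (f x) hx'
      (frobeniusDescent f hX hinj H ((Opens.map e).obj U)
        (X.presheaf.map (homOfLE (preimage_map_le f e he U)).op s)))) :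
    IsUnit (X.presheaf.germ U x hx s) := by
  have h1 := h.map (f.stalkMap x).hom
  erw [Scheme.Hom.germ_stalkMap_apply] at h1
  rw [app_frobeniusDescent, map_pow, isUnit_pow_iff hp.out.ne_zero] at h1
  erw [X.presheaf.germ_res_apply] at h1
  exact h1

/-- On points `h` is the inverse `e` of the homeomorphism `f`; on functions it is the descended
`p`-th power. -/
lemma exists_frobenius_factor (f : X ⟶ Y) {p : ℕ} [Fact p.Prime] (hX : (p : Γ(X, ⊤)) = 0)
    (hinj : ∀ V : Y.Opens, Function.Injective (f.app V))
    (H : ∀ (V : Y.Opens) (s : Γ(X, f ⁻¹ᵁ V)), ∃ t : Γ(Y, V), f.app V t = s ^ p)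
    (hf : IsHomeomorph f) :
    ∃ h : Y ⟶ X, f ≫ h = absoluteFrobenius p X hX := by
  let e : (Y : TopCat) ⟶ (X : TopCat) :=
    TopCat.ofHom ⟨hf.homeomorph.symm, hf.homeomorph.symm.continuous⟩
  have he : ∀ x : X, e (f x) = x := hf.homeomorph.symm_apply_apply
  refine ⟨⟨frobeniusFactorHom f hX hinj H e he, ?_⟩, ?_⟩
  · intro y
    refine ⟨fun a ha => ?_⟩
    obtain ⟨U, hxU, s, rfl⟩ := X.presheaf.exists_germ_eq a
    have h1 := PresheafedSpace.stalkMap_germ_apply (frobeniusFactorHom f hX hinj H e he) U y hxU s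
    obtain ⟨x, rfl⟩ := hf.surjective y
    have hxU' : x ∈ U := he x ▸ hxU
    have h2 := isUnit_germ_frobeniusDescent f hX hinj H e he U s x hxU' hxU (by
      erw [h1] at ha
      exact ha)
    rw [← Scheme.mem_basicOpen] at h2 ⊢
    exact (he x).symm ▸ h2
  · refine Scheme.Hom.ext ?_ ?_
    · ext x
      exact he x
    · intro U
      ext s
      have hU : U = f ⁻¹ᵁ ((Opens.map e).obj U) :=
        le_antisymm (fun x hx => by change e (f x) ∈ U; rwa [he]) (preimage_map_le f e he U)
      have h1 := app_frobeniusDescent f hX hinj H ((Opens.map e).obj U)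
        (X.presheaf.map (homOfLE (preimage_map_le f e he U)).op s)
      have h2 := congrArg (X.presheaf.map (eqToHom hU).op) h1
      refine Eq.trans h2 ?_
      rw [map_pow]
      refine Eq.trans ?_ (absoluteFrobenius_app p X hX U s).symm
      congr 1
      simp only [← CommRingCat.comp_apply, ← Functor.map_comp]
      exact congr($(X.presheaf.map_id _) s)

end

/-! ### The foliation of a morphism -/

variable {k : Type u} [Field k]

lemma res_res {X : NormalVariety k} {U V W : X.scheme.Opens} (h : V ≤ U) (h' : W ≤ V)
    (s : Γ(X.scheme, U)) : res h' (res h s) = res (h'.trans h) s := by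
  simp only [res, ← RingHom.comp_apply, ← CommRingCat.hom_comp, ← Functor.map_comp]
  rfl

lemma res_injective {X : NormalVariety k} {U V : X.scheme.Opens} (h : V ≤ U) [Nonempty V] :
    Function.Injective (res h) :=
  map_injective_of_isIntegral X.scheme (homOfLE h)

/-- Restriction and passage to the function field are injective only for nonempty opens; this covers
the empty ones. -/
lemma subsingleton_sections {X : Scheme.{u}} (U : X.Opens) (hU : ¬ Nonempty U) :
    Subsingleton Γ(X, U) := by
  have : U = ⊥ := by
    ext x
    simpa using fun hx => hU ⟨⟨x, hx⟩⟩
  subst this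
  exact CommRingCat.subsingleton_of_isTerminal X.sheaf.isTerminalOfEmpty

lemma res_mem_inverseImageSections {X Y : NormalVariety k} (f : X ⟶ Y) {U V : X.scheme.Opens}
    (h : V ≤ U) {s : Γ(X.scheme, U)} (hs : s ∈ inverseImageSections f U) :
    res h s ∈ inverseImageSections f V := by
  intro x hx
  obtain ⟨W, t, V', h₁, h₂, hx', hst⟩ := hs x (h hx)
  refine ⟨W, t, V' ⊓ V, inf_le_right, inf_le_left.trans h₂, ⟨hx', hx⟩, ?_⟩
  rw [res_res, ← res_res h₁ inf_le_left, hst, res_res]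

/-- The derivations that annihilate `f⁻¹O_Y` form a `p`-closed foliation. -/
lemma isPClosedFoliation_foliationOf (p : ℕ) [Fact p.Prime] [CharP k p] {X Y : NormalVariety k}
    (f : X ⟶ Y) : IsPClosedFoliation p (foliationOf f) where
  zero_mem U V hV s hs := rfl
  add_mem U D hD E hE V hV s hs := by
    change D.der V hV s + E.der V hV s = 0
    rw [hD V hV s hs, hE V hV s hs, add_zero]
  smul_mem U r D hD V hV s hs := by
    change res hV r • D.der V hV s = 0
    rw [hD V hV s hs, smul_zero]
  restrict_mem U D hD V h W hW s hs := hD W (hW.trans h) s hs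
  mem_of_local U D hD V hV s hs := by
    by_cases hne : Nonempty V
    · obtain ⟨x, hxV⟩ := hne
      obtain ⟨V', h, hx, hD'⟩ := hD x (hV hxV)
      have : Nonempty (V' ⊓ V : X.scheme.Opens) := ⟨⟨x, hx, hxV⟩⟩
      apply res_injective (inf_le_right : V' ⊓ V ≤ V)
      rw [map_zero, ← D.der_res]
      exact hD' _ inf_le_left _ (res_mem_inverseImageSections f _ hs)
    · have := subsingleton_sections V hne
      exact Subsingleton.elim _ _
  saturated U r D hr hD V hV s hs := by
    by_cases hne : Nonempty V
    · have h1 : res hV r * D.der V hV s = 0 := hD V hV s hs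
      refine (mul_eq_zero.mp h1).resolve_left fun h2 => hr ?_
      exact res_injective hV (h2.trans (map_zero _).symm)
    · have := subsingleton_sections V hne
      exact Subsingleton.elim _ _
  bracket_mem U D hD E hE V hV s hs := by
    change ⁅D.der V hV, E.der V hV⁆ s = 0
    rw [Derivation.commutator_apply, hD V hV s hs, hE V hV s hs, map_zero, map_zero, sub_zero]
  pow_mem U D hD := by
    have hp0 : ∀ V : X.scheme.Opens, (p : Γ(X.scheme, V)) = 0 :=
      natCast_sections_eq_zero p X.scheme (natCast_eq_zero p X)
    have hzero : ∀ V hV (s : Γ(X.scheme, V)), D.der V hV s = 0 → (D.der V hV)^[p] s = 0 := by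
      intro V hV s hs
      obtain ⟨n, hn⟩ := Nat.exists_eq_succ_of_ne_zero (Fact.out : p.Prime).ne_zero
      rw [hn, Function.iterate_succ_apply, hs, iterate_map_zero]
    refine ⟨{ der := fun V hV => powDerivation p (hp0 V) (D.der V hV)
              der_constants := fun V hV a => ?_
              der_res := fun V hV W h s => ?_ }, fun V hV s hs => ?_, fun V hV s => ?_⟩
    · rw [powDerivation_apply, hzero _ _ _ (D.der_constants V hV a)]
    · rw [powDerivation_apply, powDerivation_apply]
      exact (Function.Semiconj.iterate_right (f := res h) (ga := D.der V hV)
        (gb := D.der W (h.trans hV)) (fun s => (D.der_res V hV W h s).symm) p s).symm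
    · exact (powDerivation_apply p (hp0 V) _ s).trans (hzero _ _ _ (hD V hV s hs))
    · exact powDerivation_apply p (hp0 V) _ s

/-! ### Vector fields from derivations of the function field -/

/-- A derivation that maps a subring to itself restricts to a derivation of the subring. -/
lemma exists_derivation_restrict {A K : Type*} [CommRing A] [CommRing K] (i : A →+* K)
    (hi : Function.Injective i) (E : Derivation ℤ K K) (h : ∀ a, ∃ a', i a' = E (i a)) :
    ∃ D : Derivation ℤ A A, ∀ a, i (D a) = E (i a) := by
  choose d hd using h
  let D₀ : A →+ A :=
    { toFun := d
      map_zero' := hi (by simp [hd])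
      map_add' := fun a b => hi (by simp [hd]) }
  refine ⟨Derivation.mk' D₀.toIntLinearMap fun a b => hi ?_, hd⟩
  change i (d (a * b)) = i (a * d b + b * d a)
  simp [hd]

section

variable {X : Scheme.{u}} [IsIntegral X]

/-- A derivation of the function field that preserves the functions on an affine open subset
preserves the functions on every smaller open subset. -/
lemma exists_germ_eq_derivation (E : Derivation ℤ X.functionField X.functionField) {W : X.Opens}
    (hW : IsAffineOpen W) [Nonempty W]
    (hE : ∀ a : Γ(X, W), ∃ a' : Γ(X, W), X.germToFunctionField W a' = E (X.germToFunctionField W a))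
    (V : X.Opens) [Nonempty V] (hVW : V ≤ W) (s : Γ(X, V)) :
    ∃ s' : Γ(X, V), X.germToFunctionField V s' = E (X.germToFunctionField V s) := by
  refine exists_germToFunctionField_eq_of_local V _ fun y hy => ?_
  let := TopCat.Presheaf.algebra_section_stalk X.presheaf (⟨y, hVW hy⟩ : W)
  have := hW.isLocalization_stalk ⟨y, hVW hy⟩
  -- Near `y` one has `s = c / a` with `a` a unit at `y`, and the quotient rule in the form `E s =
  -- (E c - s * E a) / a` shows that `E s` is regular there.
  obtain ⟨⟨c, a⟩, hca⟩ := IsLocalization.surj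
    (hW.primeIdealOf ⟨y, hVW hy⟩).asIdeal.primeCompl (X.presheaf.germ V y hy s)
  obtain ⟨u, hu⟩ := IsLocalization.map_units (X.presheaf.stalk y) a
  obtain ⟨a', ha'⟩ := hE a
  obtain ⟨c', hc'⟩ := hE c
  let ι := algebraMap (X.presheaf.stalk y) X.functionField
  have hgW : ∀ t : Γ(X, W), ι (X.presheaf.germ W y (hVW hy) t) = X.germToFunctionField W t :=
    X.algebraMap_germ_eq_germToFunctionField (hVW hy)
  have hgV : ι (X.presheaf.germ V y hy s) = X.germToFunctionField V s :=
    X.algebraMap_germ_eq_germToFunctionField hy s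
  have h1 : X.germToFunctionField V s * X.germToFunctionField W a = X.germToFunctionField W c := by
    rw [← hgV, ← hgW, ← hgW, ← map_mul]
    exact congrArg ι hca
  have h2 := congrArg E h1
  rw [E.leibniz, smul_eq_mul, smul_eq_mul] at h2
  obtain ⟨V', hy', s', hs'⟩ := X.presheaf.exists_germ_eq
    ((X.presheaf.germ W y (hVW hy) c' -
      X.presheaf.germ V y hy s * X.presheaf.germ W y (hVW hy) a') * (↑u⁻¹ : X.presheaf.stalk y))
  have : Nonempty V' := ⟨⟨y, hy'⟩⟩
  refine ⟨V', inferInstance, s', hy', ?_⟩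
  rw [← X.algebraMap_germ_eq_germToFunctionField hy', hs', map_mul, map_sub, map_mul]
  have hu' : ι (u : X.presheaf.stalk y) = X.germToFunctionField W a := by
    rw [hu]; exact hgW a
  have h3 : ι (u : X.presheaf.stalk y) * ι (↑u⁻¹ : X.presheaf.stalk y) = 1 := by
    rw [← map_mul, Units.mul_inv, map_one]
  change (ι _ - ι _ * ι _) * ι _ = _
  rw [hgW, hgW, hgV, hc', ha', ← h2, add_sub_cancel_left, ← hu', mul_right_comm, h3, one_mul]

end

/-- Morphisms over `k` preserve constant functions. -/
lemma app_constants_top {X Y : NormalVariety k} (f : X ⟶ Y) (a : k) :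
    (schemeMap f).app ⊤ (constants Y ⊤ a) = constants X ⊤ a := by
  have h := congr($(congrArg Scheme.Hom.appTop (Over.w f.hom))
    ((Scheme.ΓSpecIso (CommRingCat.of k)).inv a))
  have hX : constants X ⊤ a = X.obj.hom.appTop ((Scheme.ΓSpecIso (CommRingCat.of k)).inv a) :=
    congr($(X.scheme.presheaf.map_id (op ⊤)) _)
  have hY : constants Y ⊤ a = Y.obj.hom.appTop ((Scheme.ΓSpecIso (CommRingCat.of k)).inv a) :=
    congr($(Y.scheme.presheaf.map_id (op ⊤)) _)
  rw [hX, hY]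
  exact h

/-- A derivation of the function field of `X` over that of `Y` that preserves the functions on
an affine open subset defines a section of the foliation of `X → Y`. -/
lemma exists_mem_foliationOf {X Y : NormalVariety k} (f : X ⟶ Y) (hf : Surjective (schemeMap f))
    (E : Derivation ℤ X.scheme.functionField X.scheme.functionField)
    (hEL : ∀ l, E (functionFieldMap (schemeMap f) hf l) = 0) {W : X.scheme.Opens}
    (hW : IsAffineOpen W) [Nonempty W]
    (hE : ∀ a : Γ(X.scheme, W), ∃ a' : Γ(X.scheme, W),
      X.scheme.germToFunctionField W a' = E (X.scheme.germToFunctionField W a)) :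
    ∃ T ∈ foliationOf f W, ∀ s, X.scheme.germToFunctionField W (T.der W le_rfl s) =
      E (X.scheme.germToFunctionField W s) := by
  have hex : ∀ V : X.scheme.Opens, V ≤ W → ∃ D : Derivation ℤ Γ(X.scheme, V) Γ(X.scheme, V),
      ∀ (_ : Nonempty V) (s : Γ(X.scheme, V)), X.scheme.germToFunctionField V (D s) =
        E (X.scheme.germToFunctionField V s) := by
    intro V hV
    by_cases hne : Nonempty V
    · obtain ⟨D, hD⟩ := exists_derivation_restrict (X.scheme.germToFunctionField V).hom
        (X.scheme.germToFunctionField_injective V) E (exists_germ_eq_derivation E hW hE V hV)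
      exact ⟨D, fun _ => hD⟩
    · exact ⟨0, fun h => absurd h hne⟩
  choose D hD using hex
  have hkill : ∀ V hV, ∀ s ∈ inverseImageSections f V, D V hV s = 0 := by
    intro V hV s hs
    by_cases hne : Nonempty V
    · obtain ⟨x, hx⟩ := id hne
      obtain ⟨U, t, V', h, h', hx', hst⟩ := hs x hx
      have : Nonempty V' := ⟨⟨x, hx'⟩⟩
      have : Nonempty (schemeMap f ⁻¹ᵁ U : X.scheme.Opens) := ⟨⟨x, h' hx'⟩⟩
      have : Nonempty U := ⟨⟨_, h' hx'⟩⟩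
      apply X.scheme.germToFunctionField_injective V
      rw [hD, map_zero, ← germToFunctionField_map h]
      have h1 := (congrArg (X.scheme.germToFunctionField V') hst).trans
        (germToFunctionField_map h' _)
      rw [← functionFieldMap_germToFunctionField (schemeMap f) hf] at h1
      exact (congrArg E h1).trans (hEL _)
    · have := subsingleton_sections V hne
      exact Subsingleton.elim _ _
  refine ⟨{ der := D
            der_constants := fun V hV a => hkill V hV _ fun x hx => ?_
            der_res := fun V hV V' h s => ?_ }, hkill, hD W le_rfl inferInstance⟩
  -- Constants on `X` are pulled back from `Y`, so they are among the functions already killed.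
  · refine ⟨⊤, constants Y ⊤ a, V, le_rfl, le_top, hx, ?_⟩
    rw [app_constants_top]
    change res le_rfl (res le_top _) = res le_top (res le_top _)
    rw [res_res, res_res]
  · by_cases hne : Nonempty V'
    · have : Nonempty V := ⟨⟨_, h hne.some.2⟩⟩
      apply X.scheme.germToFunctionField_injective V'
      rw [hD]
      exact (congrArg E (germToFunctionField_map h s)).trans
        ((hD V hV this s).symm.trans (germToFunctionField_map h _).symm)
    · have := subsingleton_sections V' hne
      exact Subsingleton.elim _ _

/-! ### Quotients by foliations -/

instance charP_functionField (p : ℕ) [CharP k p] (X : NormalVariety k) :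
    CharP X.scheme.functionField p := by
  have : Nonempty (⊤ : X.scheme.Opens) := ⟨⟨genericPoint X.scheme, trivial⟩⟩
  exact charP_of_injective_ringHom
    (f := (X.scheme.germToFunctionField ⊤).hom.comp (constants X ⊤)) (RingHom.injective _) p

/-- A finite morphism whose extension of function fields contains a power of every element
has a finite extension of function fields. -/
lemma finite_functionFieldMap {X Y : Scheme.{u}} [IsIntegral X] [IsIntegral Y] (f : X ⟶ Y)
    (hf : Surjective f) [IsFinite f]
    (halg : ∀ x : X.functionField, ∃ n > 0, x ^ n ∈ (functionFieldMap f hf).range) :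
    (functionFieldMap f hf).Finite := by
  obtain ⟨U, hU, hyU⟩ := exists_affineOpen_mem (genericPoint Y)
  have : Nonempty U := ⟨⟨_, hyU⟩⟩
  have := nonempty_preimage f hf U
  have := functionField_isFractionRing_of_isAffineOpen X _ (hU.preimage f)
  let := (functionFieldMap f hf).toAlgebra
  let := (f.app U).hom.toAlgebra
  have hfin : Module.Finite Γ(Y, U) Γ(X, f ⁻¹ᵁ U) := f.finite_app U hU
  obtain ⟨S, hS⟩ := hfin.fg_top
  classical
  refine ⟨S.image (X.germToFunctionField (f ⁻¹ᵁ U)), ?_⟩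
  set N := Submodule.span Y.functionField
    (S.image (X.germToFunctionField (f ⁻¹ᵁ U)) : Set X.functionField) with hN
  have hmem : ∀ a : Γ(X, f ⁻¹ᵁ U), X.germToFunctionField (f ⁻¹ᵁ U) a ∈ N := by
    intro a
    have ha : a ∈ Submodule.span Γ(Y, U) (S : Set Γ(X, f ⁻¹ᵁ U)) := hS ▸ Submodule.mem_top
    induction ha using Submodule.span_induction with
    | mem a ha => exact Submodule.subset_span (by simpa using ⟨a, ha, rfl⟩)
    | zero => rw [map_zero]; exact N.zero_mem
    | add a b _ _ ha hb => rw [map_add]; exact N.add_mem ha hb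
    | smul b a _ ha =>
      have : X.germToFunctionField (f ⁻¹ᵁ U) (b • a) =
          Y.germToFunctionField U b • X.germToFunctionField (f ⁻¹ᵁ U) a := by
        change X.germToFunctionField (f ⁻¹ᵁ U) (f.app U b * a) =
          functionFieldMap f hf (Y.germToFunctionField U b) * _
        rw [map_mul, functionFieldMap_germToFunctionField]
      rw [this]
      exact N.smul_mem _ ha
  rw [eq_top_iff]
  intro x _
  obtain ⟨a, b, hb, rfl⟩ := IsFractionRing.div_surjective (A := Γ(X, f ⁻¹ᵁ U)) x
  have hb0 : algebraMap Γ(X, f ⁻¹ᵁ U) X.functionField b ≠ 0 :=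
    IsFractionRing.to_map_ne_zero_of_mem_nonZeroDivisors hb
  obtain ⟨n, hn, l, hl⟩ := halg (algebraMap Γ(X, f ⁻¹ᵁ U) X.functionField b)
  -- Writing `a / b = a * b ^ (n - 1) / b ^ n` puts the denominator in the function field of `Y`, so
  -- module generators of `Γ(X, f ⁻¹ᵁ U)` span.
  have : algebraMap Γ(X, f ⁻¹ᵁ U) X.functionField a / algebraMap Γ(X, f ⁻¹ᵁ U) X.functionField b =
      l⁻¹ • algebraMap Γ(X, f ⁻¹ᵁ U) X.functionField (a * b ^ (n - 1)) := by
    change _ = functionFieldMap f hf l⁻¹ * _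
    obtain ⟨n, rfl⟩ := Nat.exists_eq_add_of_lt hn
    rw [map_inv₀, hl]
    simp only [zero_add, add_tsub_cancel_right, map_mul, map_pow]
    field_simp
    ring
  rw [this]
  exact N.smul_mem _ (hmem _)

/-- If the function field of `Y` contains all `p`-th powers of rational functions on `X`, then the
functions annihilated by the foliation of `X → Y` are those of `Y`. -/
lemma range_app_eq_annihilated (p : ℕ) [hp : Fact p.Prime] [CharP k p] {X Y : NormalVariety k}
    (f : X ⟶ Y) (hf : Surjective (schemeMap f)) [IsFinite (schemeMap f)]
    (hpow : ∀ x, x ^ p ∈ (functionFieldMap (schemeMap f) hf).range) (V : Y.scheme.Opens) :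
    Set.range ((schemeMap f).app V) = annihilated (foliationOf f) (schemeMap f ⁻¹ᵁ V) := by
  ext s
  constructor
  · rintro ⟨t, rfl⟩ V' h D hD
    exact hD V' le_rfl _ fun x hx => ⟨V, t, V', le_rfl, h, hx, res_res _ _ _⟩
  intro hs
  by_cases hne : Nonempty V
  swap
  · have hne' : ¬ Nonempty (schemeMap f ⁻¹ᵁ V : X.scheme.Opens) := fun ⟨x⟩ => hne ⟨⟨_, x.2⟩⟩
    have := subsingleton_sections _ hne'
    exact ⟨0, Subsingleton.elim _ _⟩
  have hne' := nonempty_preimage (schemeMap f) hf V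
  apply mem_range_app_of_germ_mem_range (schemeMap f) hf Y.property.normal V s
  by_contra hcon
  -- If `s` is not rational on `Y`, some derivation over the function field of `Y` moves it. A
  -- multiple of this derivation will be a vector field in the foliation.
  obtain ⟨E, hEL, hEs⟩ : ∃ E : Derivation ℤ X.scheme.functionField X.scheme.functionField,
      (∀ l, E (functionFieldMap (schemeMap f) hf l) = 0) ∧
        E (X.scheme.germToFunctionField _ s) ≠ 0 := by
    let := (functionFieldMap (schemeMap f) hf).toAlgebra
    have : FiniteDimensional Y.scheme.functionField X.scheme.functionField :=
      finite_functionFieldMap (schemeMap f) hf fun x => ⟨p, hp.out.pos, hpow x⟩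
    obtain ⟨D, hD⟩ := exists_derivation_apply_ne_zero p hpow hcon
    exact ⟨D.restrictScalars ℤ, D.map_algebraMap, hD⟩
  obtain ⟨_, ⟨U, hU, rfl⟩, hyU, hUV⟩ := Y.scheme.isBasis_affineOpens.exists_subset_of_mem_open
    hne.some.2 V.isOpen
  have : Nonempty U := ⟨⟨_, hyU⟩⟩
  have := nonempty_preimage (schemeMap f) hf U
  have hWaff := hU.preimage (schemeMap f)
  set W := schemeMap f ⁻¹ᵁ U with hW
  have := functionField_isFractionRing_of_isAffineOpen X.scheme _ hWaff
  -- `d` is a common denominator of the values of `E` on finitely many generators of `Γ(X, W)` over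
  -- `Γ(Y, U)`. It works for every function because `E` is linear over `Γ(Y, U)`.
  obtain ⟨d, hd, hdE⟩ : ∃ d : Γ(X.scheme, W), d ≠ 0 ∧ ∀ a : Γ(X.scheme, W), ∃ a' : Γ(X.scheme, W),
      X.scheme.germToFunctionField W a' =
        (X.scheme.germToFunctionField W d • E) (X.scheme.germToFunctionField W a) := by
    let := ((schemeMap f).app U).hom.toAlgebra
    have hfin : Module.Finite Γ(Y.scheme, U) Γ(X.scheme, W) := (schemeMap f).finite_app U hU
    obtain ⟨S, hS⟩ := hfin.fg_top
    classical
    obtain ⟨d, hd⟩ := IsLocalization.exist_integer_multiples_of_finset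
      (nonZeroDivisors Γ(X.scheme, W)) (S.image fun a => E (X.scheme.germToFunctionField W a))
    refine ⟨d, nonZeroDivisors.coe_ne_zero d, fun a => ?_⟩
    have ha : a ∈ Submodule.span Γ(Y.scheme, U) (S : Set Γ(X.scheme, W)) := hS ▸ Submodule.mem_top
    induction ha using Submodule.span_induction with
    | mem a ha =>
      obtain ⟨a', ha'⟩ := hd (E (X.scheme.germToFunctionField W a))
        (Finset.mem_image_of_mem _ ha)
      exact ⟨a', ha'.trans (Algebra.smul_def _ _)⟩
    | zero => exact ⟨0, by simp⟩
    | add a b _ _ ha hb =>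
      obtain ⟨a', ha'⟩ := ha
      obtain ⟨b', hb'⟩ := hb
      exact ⟨a' + b', by rw [map_add, map_add, map_add, ha', hb']⟩
    | smul b a _ ha =>
      obtain ⟨a', ha'⟩ := ha
      refine ⟨b • a', ?_⟩
      have key : ∀ a, X.scheme.germToFunctionField W (b • a) =
          functionFieldMap (schemeMap f) hf (Y.scheme.germToFunctionField U b) *
            X.scheme.germToFunctionField W a := by
        intro a
        change X.scheme.germToFunctionField W ((schemeMap f).app U b * a) = _
        rw [map_mul, functionFieldMap_germToFunctionField]
      rw [key, key, Derivation.leibniz, ha', Derivation.smul_apply, Derivation.smul_apply, hEL]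
      simp
  obtain ⟨T, hT, hTs⟩ := exists_mem_foliationOf f hf (X.scheme.germToFunctionField W d • E)
    (fun l => by rw [Derivation.smul_apply, hEL, smul_zero]) hWaff hdE
  have hWV : W ≤ schemeMap f ⁻¹ᵁ V := (schemeMap f).preimage_mono hUV
  have h0 := hTs (res hWV s)
  rw [hs W hWV T hT, map_zero, Derivation.smul_apply, smul_eq_mul] at h0
  rcases mul_eq_zero.mp h0.symm with h1 | h1
  · exact hd (X.scheme.germToFunctionField_injective W (h1.trans (map_zero _).symm))
  · exact hEs ((congrArg E (germToFunctionField_map hWV s)).symm.trans h1)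

/-- A finite morphism of normal varieties such that the function field of the target contains the
`p`-th powers is purely inseparable of height one, and it is the quotient by its foliation. -/
lemma heightOne_and_isQuotientBy (p : ℕ) [hp : Fact p.Prime] [CharP k p] {X Y : NormalVariety k}
    (f : X ⟶ Y) (hf : Surjective (schemeMap f)) [IsFinite (schemeMap f)]
    (hpow : ∀ x, x ^ p ∈ (functionFieldMap (schemeMap f) hf).range) :
    IsPurelyInseparableOfHeightOne p f ∧ IsQuotientBy p (foliationOf f) f := by
  have : IsSchemeTheoreticallyDominant (schemeMap f) := .of_isDominant (schemeMap f)
  have hinj : ∀ V : Y.scheme.Opens, Function.Injective ((schemeMap f).app V) :=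
    (schemeMap f).app_injective
  -- A `p`-th power of a function on `X` is rational on `Y` by `hpow`, hence regular on `Y` by
  -- normality.
  have H : ∀ (V : Y.scheme.Opens) (s : Γ(X.scheme, schemeMap f ⁻¹ᵁ V)),
      ∃ t : Γ(Y.scheme, V), (schemeMap f).app V t = s ^ p := by
    intro V s
    by_cases hne : Nonempty V
    · have := nonempty_preimage (schemeMap f) hf V
      refine mem_range_app_of_germ_mem_range (schemeMap f) hf Y.property.normal V (s ^ p) ?_
      rw [map_pow]
      exact hpow _
    · have hne' : ¬ Nonempty (schemeMap f ⁻¹ᵁ V : X.scheme.Opens) := fun ⟨x⟩ => hne ⟨⟨_, x.2⟩⟩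
      have := subsingleton_sections _ hne'
      exact ⟨0, Subsingleton.elim _ _⟩
  have hhom := isHomeomorph_of_forall_exists_pow (schemeMap f) hf hp.out.pos H
  obtain ⟨h, hh⟩ := exists_frobenius_factor (schemeMap f) (natCast_eq_zero p X) hinj H hhom
  have hhx : ∀ x, h (schemeMap f x) = x := fun x => congr($(hh) x)
  have haff : IsAffineHom h := by
    refine isAffineHom_of_forall_exists_isAffineOpen h fun x => ?_
    obtain ⟨U, hU, hxU⟩ := exists_affineOpen_mem (schemeMap f x)
    refine ⟨schemeMap f ⁻¹ᵁ U, hxU, hU.preimage _, ?_⟩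
    -- On points `h` is inverse to `f`, so the preimage under `h` of the affine open `f ⁻¹ᵁ U` is
    -- the affine open `U`.
    have : h ⁻¹ᵁ schemeMap f ⁻¹ᵁ U = U := by
      ext y
      obtain ⟨x, rfl⟩ := hf.surj y
      change schemeMap f (h (schemeMap f x)) ∈ U ↔ _
      rw [hhx]
      rfl
    rwa [this]
  refine ⟨⟨⟨inferInstance, hf, ?_⟩, h, hh⟩, h, hh, haff, fun U => ⟨hinj _, ?_⟩⟩
  · let := (functionFieldMap (schemeMap f) hf).toAlgebra
    rw [isPurelyInseparable_iff_pow_mem _ p]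
    exact fun x => ⟨1, by rw [pow_one]; exact hpow x⟩
  · exact range_app_eq_annihilated p f hf hpow _

/-! ### The factorisation -/

lemma inverseImageSections_comp_subset {X Y Z : NormalVariety k} (g : X ⟶ Z) (f : Z ⟶ Y)
    (V : X.scheme.Opens) : inverseImageSections (g ≫ f) V ⊆ inverseImageSections g V := by
  intro s hs x hx
  obtain ⟨W, t, V', h, h', hx', hst⟩ := hs x hx
  refine ⟨schemeMap f ⁻¹ᵁ W, (schemeMap f).app W t, V', h, h', hx', hst.trans ?_⟩
  exact congrArg (res h') (congr($(Scheme.Hom.comp_app (schemeMap g) (schemeMap f) W) t))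

/-- A vector field that annihilates the functions on `Y` annihilates the functions on `Z` if
the function field of `Z` is generated by that of `Y` and `p`-th powers on `X`. -/
lemma foliationOf_comp (p : ℕ) [CharP k p] {X Y Z : NormalVariety k} (g : X ⟶ Z) (f : Z ⟶ Y)
    (hg : Surjective (schemeMap g)) (hgf : Surjective (schemeMap (g ≫ f)))
    (hM : (functionFieldMap (schemeMap g) hg).fieldRange ≤
      Subfield.closure (↑(functionFieldMap (schemeMap (g ≫ f)) hgf).fieldRange ∪
        Set.range (fun x => x ^ p))) :
    foliationOf (g ≫ f) = foliationOf g := by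
  funext U
  refine Set.Subset.antisymm (fun D hD V hV s hs => ?_)
    fun D hD V hV s hs => hD V hV s (inverseImageSections_comp_subset g f V hs)
  by_cases hne : Nonempty V
  swap
  · have := subsingleton_sections V hne
    exact Subsingleton.elim _ _
  obtain ⟨x, hxV⟩ := hne
  obtain ⟨W, t, V', h, h', hx', hst⟩ := hs x hxV
  obtain ⟨UY, hUY, hxUY⟩ := exists_affineOpen_mem (schemeMap (g ≫ f) x)
  -- On an affine `A` lying over an affine `UY`, both function fields are fraction fields of rings
  -- of sections, so the question becomes one about a derivation of `Γ(X, A)`.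
  obtain ⟨_, ⟨A, hA, rfl⟩, hxA, hAV⟩ := X.scheme.isBasis_affineOpens.exists_subset_of_mem_open
    (show x ∈ (V' ⊓ schemeMap (g ≫ f) ⁻¹ᵁ UY : X.scheme.Opens) from ⟨hx', hxUY⟩)
    (V' ⊓ schemeMap (g ≫ f) ⁻¹ᵁ UY : X.scheme.Opens).isOpen
  replace hAV : A ≤ V' ⊓ schemeMap (g ≫ f) ⁻¹ᵁ UY := hAV
  have hAV' : A ≤ V' := hAV.trans inf_le_left
  have hAU : A ≤ schemeMap (g ≫ f) ⁻¹ᵁ UY := hAV.trans inf_le_right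
  have : Nonempty A := ⟨⟨x, hxA⟩⟩
  have : Nonempty W := ⟨⟨_, h' hx'⟩⟩
  have := nonempty_preimage (schemeMap g) hg W
  have : Nonempty UY := ⟨⟨_, hxUY⟩⟩
  have := nonempty_preimage (schemeMap (g ≫ f)) hgf UY
  apply res_injective (hAV'.trans h)
  rw [map_zero, ← D.der_res]
  have := functionField_isFractionRing_of_isAffineOpen X.scheme _ hA
  have := functionField_isFractionRing_of_isAffineOpen Y.scheme _ hUY
  have hkill : ∀ b : Γ(Y.scheme, UY), D.der A ((hAV'.trans h).trans hV)
      (res hAU ((schemeMap (g ≫ f)).app UY b)) = 0 := fun b =>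
    hD A _ _ fun y hy => ⟨UY, b, A, le_rfl, hAU, hy, res_res _ _ _⟩
  have hgerm : ∀ b : Γ(Y.scheme, UY), functionFieldMap (schemeMap (g ≫ f)) hgf
      (algebraMap Γ(Y.scheme, UY) Y.scheme.functionField b) =
      algebraMap Γ(X.scheme, A) X.scheme.functionField
        (res hAU ((schemeMap (g ≫ f)).app UY b)) := fun b =>
    (functionFieldMap_germToFunctionField (schemeMap (g ≫ f)) hgf UY b).trans
      (germToFunctionField_map hAU _).symm
  refine derivation_apply_eq_zero_of_mem_subfield (K := X.scheme.functionField) p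
    (natCast_sections_eq_zero p X.scheme (natCast_eq_zero p X) A) _
    (functionFieldMap (schemeMap (g ≫ f)) hgf).fieldRange ?_ _ hM ?_
  · rintro _ ⟨l, rfl⟩
    obtain ⟨b, c, hc, rfl⟩ := IsFractionRing.div_surjective (A := Γ(Y.scheme, UY)) l
    refine ⟨_, _, ?_, hkill b, hkill c, by rw [map_div₀, hgerm, hgerm]⟩
    intro h0
    have h1 := hgerm c
    rw [h0, map_zero, map_eq_zero] at h1
    exact IsFractionRing.to_map_ne_zero_of_mem_nonZeroDivisors hc h1
  · refine ⟨Z.scheme.germToFunctionField W t, ?_⟩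
    rw [functionFieldMap_germToFunctionField]
    rw [← res_res h hAV', hst, res_res]
    exact (germToFunctionField_map _ _).symm

/-- The elements whose `p ^ e`-th powers lie in a subfield contain what is generated by
that subfield and the `p`-th powers, if all `p ^ (e + 1)`-th powers lie in the subfield. -/
lemma pow_mem_of_mem_closure {K : Type*} [Field K] (p : ℕ) [ExpChar K p] (L : Subfield K) {e : ℕ}
    (hL : ∀ x : K, x ^ p ^ (e + 1) ∈ L) {x : K}
    (hx : x ∈ Subfield.closure (↑L ∪ Set.range (fun x : K => x ^ p))) : x ^ p ^ e ∈ L := by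
  -- The elements whose `p ^ e`-th power lies in `L` form a subfield, so only generators need
  -- checking.
  have : Subfield.closure (↑L ∪ Set.range (fun x : K => x ^ p)) ≤
      L.comap (iterateFrobenius K p e) := by
    rw [Subfield.closure_le]
    rintro y (hy | ⟨y, rfl⟩)
    · exact L.pow_mem hy _
    · change (y ^ p) ^ p ^ e ∈ L
      rw [← pow_mul, ← pow_succ']
      exact hL y
  exact this hx

/-- A finite surjective morphism is factored by the quotients by its foliations. -/
theorem exists_factorisation_of_pow_mem (p : ℕ) [hp : Fact p.Prime] [CharP k p] (e : ℕ) :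
    ∀ (X Y : NormalVariety k) (f : X ⟶ Y) (hf : Surjective (schemeMap f))
      (_ : IsFinite (schemeMap f))
      (_ :
        ∀ x : X.scheme.functionField, x ^ p ^ (e + 1) ∈ (functionFieldMap (schemeMap f) hf).range),
    ∃ (n : ℕ) (Z : ComposableArrows (NormalVariety k) n) (hX : Z.left = X) (hY : Z.right = Y),
      f = eqToHom hX.symm ≫ Z.hom ≫ eqToHom hY ∧
      ∀ (i : ℕ) (hi : i + 1 ≤ n) (hin : i ≤ n),
        IsPurelyInseparableOfHeightOne p (Z.map' i (i + 1) (Nat.le_succ i) hi) ∧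
        IsPClosedFoliation p (foliationOf (Z.map' i n hin (Nat.le_refl n) ≫ eqToHom hY)) ∧
        IsQuotientBy p (foliationOf (Z.map' i n hin (Nat.le_refl n) ≫ eqToHom hY))
          (Z.map' i (i + 1) (Nat.le_succ i) hi) := by
  induction e with
  | zero =>
    intro X Y f hf hfin hpow
    obtain ⟨h₁, h₂⟩ := heightOne_and_isQuotientBy p f hf (by simpa using hpow)
    refine ⟨1, ComposableArrows.mk₁ f, rfl, rfl, ?_, ?_⟩
    · exact ((Category.id_comp _).trans (Category.comp_id _)).symm
    · intro i hi hin
      obtain rfl : i = 0 := by omega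
      have : (ComposableArrows.mk₁ f).map' 0 1 ≫ 𝟙 Y = f := Category.comp_id f
      refine ⟨h₁, isPClosedFoliation_foliationOf p _, ?_⟩
      exact this.symm ▸ h₂
  | succ e ih =>
    intro X Y f hf hfin hpow
    have : ExpChar X.scheme.functionField p := .prime hp.out
    have hM := fun x => pow_mem_of_mem_closure p
      (functionFieldMap (schemeMap f) hf).fieldRange (x := x) hpow
    -- The intermediate field is the one generated by the function field of `Y` and the `p`-th
    -- powers: large enough for height one, small enough to leave the foliation unchanged.
    obtain ⟨Z, g, f', rfl, hgfin, hf'fin, hf', hg, hgM⟩ := exists_intermediate_normalVariety f hf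
      (Subfield.closure (↑(functionFieldMap (schemeMap f) hf).fieldRange ∪
        Set.range (fun x => x ^ p)))
      (fun x hx => Subfield.subset_closure (Or.inl hx))
      (fun x hx => ⟨p ^ (e + 1), pow_pos hp.out.pos _, hM x hx⟩)
    have hpow_g : ∀ x, x ^ p ∈ (functionFieldMap (schemeMap g) hg).range := fun x =>
      hgM.symm.le (Subfield.subset_closure (Or.inr ⟨x, rfl⟩))
    obtain ⟨h₁, h₂⟩ := heightOne_and_isQuotientBy p g hg hpow_g
    have h₃ := foliationOf_comp p g f' hg hf hgM.le
    obtain ⟨n, Z', hX, hY, rfl, H⟩ := ih Z Y f' hf' hf'fin (by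
      intro z
      obtain ⟨y, hy⟩ := hM (functionFieldMap (schemeMap g) hg z) (hgM.le ⟨z, rfl⟩)
      refine ⟨y, (functionFieldMap (schemeMap g) hg).injective ?_⟩
      rw [map_pow, ← hy]
      exact (functionFieldMap_comp (schemeMap g) hg (schemeMap f') hf' hf y).symm)
    subst hX hY
    simp only [eqToHom_refl, Category.id_comp, Category.comp_id] at h₃ H ⊢
    have hmap : (Z'.precomp g).map' 0 (n + 1) = g ≫ Z'.hom :=
      (Z'.precomp g).map'_comp 0 1 (n + 1)
    refine ⟨n + 1, Z'.precomp g, rfl, rfl, ?_, ?_⟩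
    · exact (((Category.id_comp _).trans (Category.comp_id _)).trans hmap).symm
    · intro i hi hin
      rcases i with _ | i
      · refine ⟨h₁, isPClosedFoliation_foliationOf p _, ?_⟩
        have : (Z'.precomp g).map' 0 (n + 1) ≫ 𝟙 _ = g ≫ Z'.hom :=
          (Category.comp_id _).trans hmap
        exact (congrArg (fun a => IsQuotientBy p (foliationOf a) g) this).mpr (h₃.symm ▸ h₂)
      · obtain ⟨H₁, -, H₂⟩ := H i (Nat.le_of_succ_le_succ hi) (Nat.le_of_succ_le_succ hin)
        refine ⟨H₁, isPClosedFoliation_foliationOf p _, ?_⟩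
        -- The arrow `a` is generalized because the two composites to `Y` differ by an identity.
        have key : ∀ a, a = Z'.map' i n (Nat.le_of_succ_le_succ hin) (Nat.le_refl n) →
            IsQuotientBy p (foliationOf a)
              (Z'.map' i (i + 1) (Nat.le_succ i) (Nat.le_of_succ_le_succ hi)) := by
          rintro _ rfl
          exact H₂
        exact key _ (Category.comp_id _)

/-- The function field extension of a purely inseparable morphism has an exponent. -/
lemma IsPurelyInseparableHom.exists_pow_mem (p : ℕ) [hp : Fact p.Prime] [CharP k p]
    {X Y : NormalVariety k} (f : X ⟶ Y) (hf : IsPurelyInseparableHom (schemeMap f)) :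
    ∃ (hf' : Surjective (schemeMap f)) (e : ℕ),
      ∀ x, x ^ p ^ e ∈ (functionFieldMap (schemeMap f) hf').range := by
  obtain ⟨hfin, hs, hpi⟩ := hf
  let := (functionFieldMap (schemeMap f) hs).toAlgebra
  have : ExpChar Y.scheme.functionField p := .prime hp.out
  have : FiniteDimensional Y.scheme.functionField X.scheme.functionField :=
    finite_functionFieldMap (schemeMap f) hs fun x => by
      obtain ⟨n, hn⟩ := IsPurelyInseparable.pow_mem Y.scheme.functionField p x
      exact ⟨p ^ n, pow_pos hp.out.pos n, hn⟩
  exact ⟨hs, IsPurelyInseparable.exponent Y.scheme.functionField X.scheme.functionField,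
    IsPurelyInseparable.exponent_def' _ p⟩

end

end InsepFactor

/-- With `l = n + 1`, the variety `Z_{i+1}` of the factorisation is `Z.obj' i`. -/
theorem proposition4p1 (p : ℕ) [Fact p.Prime] (k : Type u) [Field k] [PerfectField k] [CharP k p]
    (X Y : NormalVariety k) (f : X ⟶ Y) (hf : IsPurelyInseparableHom (schemeMap f)) :
    ∃ (n : ℕ) (Z : ComposableArrows (NormalVariety k) n) (hX : Z.left = X) (hY : Z.right = Y),
      f = eqToHom hX.symm ≫ Z.hom ≫ eqToHom hY ∧
      ∀ (i : ℕ) (hi : i < n),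
        IsPurelyInseparableOfHeightOne p (Z.map' i (i + 1)) ∧
        IsPClosedFoliation p (foliationOf (Z.map' i n ≫ eqToHom hY)) ∧
        IsQuotientBy p (foliationOf (Z.map' i n ≫ eqToHom hY)) (Z.map' i (i + 1)) := by
  obtain ⟨hf', e, he⟩ := hf.exists_pow_mem p f
  -- The exponent is raised from `e` to `e + 1`, so there is always at least one step. A morphism of
  -- degree one then counts as a height one step and need not be an identity.
  obtain ⟨n, Z, hX, hY, h, H⟩ := exists_factorisation_of_pow_mem p e X Y f hf' hf.1 fun x => by
    rw [pow_succ, pow_mul]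
    exact pow_mem (he x) p
  exact ⟨n, Z, hX, hY, h, fun i hi => H i hi hi.le⟩
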